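/- Let $R$ be an associative ring with identity, let $n\ge 0$ be an integer, and let $T$ be an $n$-tilting right $R$-module of projective dimension exactly $n$. Here $T$ is called $n$-tilting if (T1) there is an exact sequence $0\to P_n\to\dots\to P_0\to T\to 0$ with all $P_i$ projective; (T2) $\mathrm{Ext}^i_R(T,T^{(\alpha)})=0$ for all $i>0$ and all sets $\alpha$; (T3) there is an exact sequence $0\to R\to T_0\to\dots\to T_n\to 0$ in which every $T_i$ is a direct summand of a direct sum of copies of $T$. Let $\mathcal D=(\mathcal D^{\le 0},\mathcal D^{\ge 0})$ be the natural $t$-structure on the derived category $D(R)$ of right $R$-modules, and let $\mathcal T=(\mathcal T^{\le 0},\mathcal T^{\ge 0})$ be the $t$-structure on $D(R)$ generated by $T$: $\mathcal T^{\le 0}$ is the smallest full subcategory of $D(R)$ that contains $T$ and is closed under extensions, positive shifts and set-indexed direct sums, and $\mathcal T^{\ge 0}=\{B\in D(R) \mid \mathrm{Hom}_{D(R)}(T,B[j])=0 \text{ for all } j<0\}$. For $m\in\mathbb Z$ write $\mathcal D^{\le m}=\mathcal D^{\le 0}[-m]$ and $\mathcal T^{\le m}=\mathcal T^{\le 0}[-m]$.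 Then $\mathcal T$ is indeed a $t$-structure, and the pair $(\mathcal D,\mathcal T)$ is of type $(n,0)$, that is: (a) $\mathcal T^{\le 0}\subseteq\mathcal D^{\le 0}$, and $0$ is the greatest integer $k$ with $\mathcal T^{\le k}\subseteq\mathcal D^{\le 0}$; (b) $\mathcal D^{\le -n}\subseteq\mathcal T^{\le 0}$, and $n$ is the least integer $m$ with $\mathcal D^{\le -m}\subseteq\mathcal T^{\le 0}$. In particular $\mathcal D^{\le -n}\subseteq\mathcal T^{\le 0}\subseteq\mathcal D^{\le 0}$. -/

import Mathlib

open CategoryTheory Category Limits Pretriangulated Triangulated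

universe w t v u

noncomputable section

section Triangulated

variable {C : Type u} [Category.{v} C] [Preadditive C] [HasZeroObject C] [HasShift C ℤ]
  [∀ (n : ℤ), (shiftFunctor C n).Additive] [Pretriangulated C]

/-- A full subcategory `P` of a triangulated category is suspended (closed under extensions and
positive shifts) and closed under those direct sums, indexed by a set of the universe `t`, that
exist in `C`. Taking an empty index set, `P` contains the zero objects; closure under
isomorphisms is also part of the closure under colimits. -/
structure IsCocompleteSuspended (P : ObjectProperty C) : Prop where
  ext (Δ : Triangle C) (hΔ : Δ ∈ distTriang C) (h₁ : P Δ.obj₁) (h₃ : P Δ.obj₃) : P Δ.obj₂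
  shift (X : C) (hX : P X) : P (X⟦(1 : ℤ)⟧)
  coprod (J : Type t) : P.IsClosedUnderColimitsOfShape (Discrete J)

/-- `Susp(E)`: the smallest suspended subcategory that contains `E` and is closed under
direct sums indexed by sets of the universe `t`. -/
def susp (E : C) : ObjectProperty C := fun X =>
  ∀ P : ObjectProperty C, IsCocompleteSuspended.{t} P → P E → P X

/-- The class of the objects `B` such that `Hom(E, B[j]) = 0` for all `j < 0`. -/
def suspCoaisle (E : C) : ObjectProperty C := fun B =>
  ∀ j : ℤ, j < 0 → ∀ f : E ⟶ B⟦j⟧, f = 0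

/-- The pair of t-structures `(D, S)` is of type `(n, k)`: it has shift `k`, that is, `k` is the
greatest integer with `S^{≤ k} ⊆ D^{≤ 0}`, and it has gap `n`, that is, `n` is the least
number with `D^{≤ -n} ⊆ S^{≤ k}`. -/
structure HasType (D S : TStructure C) (n : ℕ) (k : ℤ) : Prop where
  shift_eq : IsGreatest {m : ℤ | S.le m ≤ D.le 0} k
  gap_eq : IsLeast {m : ℤ | D.le (-m) ≤ S.le k} (n : ℤ)

end Triangulated

section Tilting

variable {R : Type u} [Ring R]

/-- `M` is a direct summand of a direct sum of copies of `T`. Here, and everywhere below, right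
`R`-modules are modules over the opposite ring `Rᵐᵒᵖ`. -/
def IsSummandOfCopies (T M : ModuleCat.{u} Rᵐᵒᵖ) : Prop :=
  ∃ α : Type u, Nonempty (Retract M (∐ fun _ : α => T))

/-- A right `R`-module `T` is `n`-tilting.

* `resolution`: there is an exact sequence `0 → P_n → ⋯ → P_0 → T → 0` with all `P_i` projective,
  that is, a projective resolution of `T` that vanishes in degrees above `n`.
* `ext_eq_zero`: `Ext^i(T, T^(α)) = 0` for all `i > 0` and all sets `α`.
* `coresolution`: there is an exact sequence `0 → R → T_0 → ⋯ → T_n → 0` where all `T_i` are direct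
  summands of direct sums of copies of `T`; that is, there are a complex `K` in degrees `0, …, n`
  with such terms and a quasi-isomorphism to `K` from the complex `R` concentrated
  in degree `0`. -/
structure IsTilting (n : ℕ) (T : ModuleCat.{u} Rᵐᵒᵖ) : Prop where
  resolution : ∃ P : ProjectiveResolution T, ∀ i : ℕ, n < i → IsZero (P.complex.X i)
  ext_eq_zero : ∀ i : ℕ, 0 < i → ∀ α : Type u, ∀ x : Abelian.Ext T (∐ fun _ : α => T) i, x = 0
  coresolution : ∃ (K : CochainComplex (ModuleCat.{u} Rᵐᵒᵖ) ℕ)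
    (ι : (CochainComplex.single₀ (ModuleCat.{u} Rᵐᵒᵖ)).obj (ModuleCat.of Rᵐᵒᵖ R) ⟶ K),
    QuasiIso ι ∧ (∀ i : ℕ, i ≤ n → IsSummandOfCopies T (K.X i)) ∧
      ∀ i : ℕ, n < i → IsZero (K.X i)

variable [HasDerivedCategory.{w} (ModuleCat.{u} Rᵐᵒᵖ)]

/-- The module `T` as an object of `D(R)`: a complex concentrated in degree `0`. -/
abbrev toDerived (T : ModuleCat.{u} Rᵐᵒᵖ) : DerivedCategory (ModuleCat.{u} Rᵐᵒᵖ) :=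
  (DerivedCategory.singleFunctor (ModuleCat.{u} Rᵐᵒᵖ) 0).obj T

end Tilting

end

/-! Let U be the smallest cocomplete suspended subcategory containing T, and V the class of F in U
with Hom(T, F[1]) = 0. The heart of the proof is a triangle F → X → Y → F[1] for every X, with F in
V and Hom(T, Y[i]) = 0 for all i ≤ 0. Membership of F in U gives the t-structure; the extra
vanishing in V gives minimality of the gap.

Tilting enters as follows. By (T3), R[n] is in U, and telescopes together with free resolutions
spread this to D^{≤ -n} ⊆ U (`prop_of_isLE_zero`). By (T3) again, if Hom(T, Z[i+k]) = 0 for 0 ≤ k ≤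
n, then H^i(Z) = 0. By (T1), Hom(T, F[i]) = 0 for F in D^{≤ a} and i > a + n.

To build the triangle, cone off approximations from T^(α)[j] for j = 0, …, 2n-1; by (T2) their
sources lie in V and earlier vanishing persists (`exists_reducesTo_step`). The resulting Z has no
cohomology in degrees -2n < i ≤ -n, so its truncation below -n lies in D^{≤ -2n}, hence in V, and
can be coned off too (`exists_reducesTo_homVanish`). Finitely many steps suffice.

For the type, U ⊆ D^{≤ 0} because D^{≤ 0} is cocomplete suspended, and the shift is 0 because T is
nonzero in degree 0. If D^{≤ -m} ⊆ U with m < n, then for i ≥ n every M[i-1] is a retract of an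
object of V (`homVanish_shift_one_of_susp`), so Ext^i(T, M) = 0, against pd T = n. -/

noncomputable section

/-! ### Coproducts in the derived category -/

section Coproducts

variable {C : Type*} [Category* C] [Abelian C]

/-- A morphism of short complexes in a functor category which is a pointwise quasi-isomorphism
is a quasi-isomorphism. -/
lemma quasiIso_of_evaluation {J : Type*} [Category* J] {S₁ S₂ : ShortComplex (J ⥤ C)}
    (φ : S₁ ⟶ S₂)
    (h : ∀ j, ShortComplex.QuasiIso (((evaluation J C).obj j).mapShortComplex.map φ)) :
    ShortComplex.QuasiIso φ := by
  rw [ShortComplex.quasiIso_iff, NatTrans.isIso_iff_isIso_app]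
  intro j
  have h₁ := h j
  rw [ShortComplex.quasiIso_iff] at h₁
  refine ((MorphismProperty.isomorphisms C).arrow_mk_iso_iff (Arrow.isoMk
    (S₁.mapHomologyIso ((evaluation J C).obj j))
    (S₂.mapHomologyIso ((evaluation J C).obj j))
    (ShortComplex.mapHomologyIso_hom_naturality φ ((evaluation J C).obj j)).symm)).1 h₁

omit [Abelian C] in
lemma colimMap_comp_coconePointUniqueUpToIso_hom {J : Type*} [Category* J]
    [HasColimitsOfShape J C] {A B : J ⥤ C} {a : Cocone A} {b : Cocone B} (ha : IsColimit a)
    (hb : IsColimit b) (β : A ⟶ B) (g : a.pt ⟶ b.pt)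
    (h : ∀ j, a.ι.app j ≫ g = β.app j ≫ b.ι.app j) :
    ((colimit.isColimit A).coconePointUniqueUpToIso ha).hom ≫ g =
      colimMap β ≫ ((colimit.isColimit B).coconePointUniqueUpToIso hb).hom := by
  apply colimit.hom_ext
  intro j
  rw [ι_colimMap_assoc]
  have h₁ := IsColimit.comp_coconePointUniqueUpToIso_hom (colimit.isColimit A) ha j
  have h₂ := IsColimit.comp_coconePointUniqueUpToIso_hom (colimit.isColimit B) hb j
  dsimp at h₁ h₂
  rw [h₂, reassoc_of% h₁, h]

/-- Exact colimits of quasi-isomorphisms are quasi-isomorphisms. -/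
lemma quasiIso_colimMap {J : Type*} [Category* J] [HasColimitsOfShape J C]
    [HasExactColimitsOfShape J C] {ι : Type*} {c : ComplexShape ι}
    {F G : J ⥤ HomologicalComplex C c} (α : F ⟶ G) (h : ∀ j, QuasiIso (α.app j)) :
    QuasiIso (colimMap α) := by
  rw [quasiIso_iff]
  intro i
  rw [quasiIsoAt_iff]
  -- The terms around degree `i`, as diagrams over `J`: a quasi-isomorphism there is tested
  -- pointwise, and the exact functor `colim` preserves it.
  let S (H : J ⥤ HomologicalComplex C c) : ShortComplex (J ⥤ C) :=
    { X₁ := H ⋙ HomologicalComplex.eval C c (c.prev i)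
      X₂ := H ⋙ HomologicalComplex.eval C c i
      X₃ := H ⋙ HomologicalComplex.eval C c (c.next i)
      f := { app j := (H.obj j).d _ _
             naturality _ _ g := (H.map g).comm _ _ }
      g := { app j := (H.obj j).d _ _
             naturality _ _ g := (H.map g).comm _ _ }
      zero := by ext j; exact (H.obj j).d_comp_d _ _ _ }
  let φ : S F ⟶ S G :=
    { τ₁ := Functor.whiskerRight α _
      τ₂ := Functor.whiskerRight α _
      τ₃ := Functor.whiskerRight α _
      comm₁₂ := by ext j; exact (α.app j).comm _ _
      comm₂₃ := by ext j; exact (α.app j).comm _ _ }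
  have hφ : ShortComplex.QuasiIso φ := quasiIso_of_evaluation _ fun j => by
    have := (quasiIso_iff (α.app j)).1 (h j) i
    rw [quasiIsoAt_iff] at this
    exact this
  have hφ' : ShortComplex.QuasiIso ((colim : (J ⥤ C) ⥤ C).mapShortComplex.map φ) :=
    inferInstance
  have hc (H : J ⥤ HomologicalComplex C c) (k : ι) :
      IsColimit ((HomologicalComplex.eval C c k).mapCocone (colimit.cocone H)) :=
    isColimitOfPreserves _ (colimit.isColimit H)
  let e (H : J ⥤ HomologicalComplex C c) : (S H).map (colim : (J ⥤ C) ⥤ C) ≅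
      (HomologicalComplex.shortComplexFunctor C c i).obj (colimit H) :=
    ShortComplex.isoMk ((colimit.isColimit _).coconePointUniqueUpToIso (hc H (c.prev i)))
      ((colimit.isColimit _).coconePointUniqueUpToIso (hc H i))
      ((colimit.isColimit _).coconePointUniqueUpToIso (hc H (c.next i)))
      (colimMap_comp_coconePointUniqueUpToIso_hom (hc H _) (hc H _) (S H).f
        ((colimit H).d _ _) fun j => (colimit.ι H j).comm _ _)
      (colimMap_comp_coconePointUniqueUpToIso_hom (hc H _) (hc H _) (S H).g
        ((colimit H).d _ _) fun j => (colimit.ι H j).comm _ _)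
  refine ShortComplex.quasiIso_of_arrow_mk_iso _ _ (Arrow.isoMk (e F) (e G) ?_) (hφ := hφ')
  have key (k : ι) := colimMap_comp_coconePointUniqueUpToIso_hom (hc F k) (hc G k)
    (Functor.whiskerRight α _) ((colimMap α).f k) fun j => by
      have := congr_arg (fun f => HomologicalComplex.Hom.f f k) (ι_colimMap α j)
      exact this
  ext
  · exact key _
  · exact key _
  · exact key _

/-- A morphism from a coproduct of complexes is homotopic to zero when all its components are. -/
def Homotopy.ofIsColimitCofan {J : Type*} [HasColimitsOfShape (Discrete J) C] {ι : Type*}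
    {c : ComplexShape ι} {K : J → HomologicalComplex C c} {s : Cofan K} (hs : IsColimit s)
    {Y : HomologicalComplex C c} (φ : s.pt ⟶ Y) (h : ∀ j, Homotopy (s.inj j ≫ φ) 0) :
    Homotopy φ 0 := by
  have hs' (i : ι) : IsColimit ((HomologicalComplex.eval C c i).mapCocone s) :=
    isColimitOfPreserves _ hs
  let H (i i' : ι) : s.pt.X i ⟶ Y.X i' := (hs' i).desc (Cocone.mk (Y.X i')
    (Discrete.natTrans fun j => (h j.as).hom i i'))
  have fac (i i' : ι) (j : J) : (s.inj j).f i ≫ H i i' = (h j).hom i i' :=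
    (hs' i).fac (Cocone.mk (Y.X i') (Discrete.natTrans fun j => (h j.as).hom i i')) ⟨j⟩
  exact
    { hom := H
      zero i i' hi := (hs' i).hom_ext fun ⟨j⟩ => by
        refine (fac i i' j).trans ?_
        rw [(h j).zero i i' hi]
        exact comp_zero.symm
      comm i := (hs' i).hom_ext fun ⟨j⟩ => by
        have h₁ := (h j).comm i
        change (s.inj j).f i ≫ φ.f i = (s.inj j).f i ≫ _
        have h₂ : dNext i (h j).hom = (s.inj j).f i ≫ dNext i H := by
          change (K j).d _ _ ≫ (h j).hom _ _ = _ ≫ s.pt.d _ _ ≫ H _ _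
          rw [← fac, (s.inj j).comm_assoc]
        have h₃ : prevD i (h j).hom = (s.inj j).f i ≫ prevD i H := by
          change (h j).hom _ _ ≫ Y.d _ _ = _ ≫ H _ _ ≫ Y.d _ _
          rw [← fac, assoc]
        rw [h₂, h₃] at h₁
        simpa using h₁ }

variable [HasDerivedCategory.{w} C]

/-- If a morphism of complexes becomes zero in the derived category, then it becomes homotopic
to zero after precomposition with a quasi-isomorphism. -/
lemma exists_homotopy_of_Q_map_eq_zero {K L : CochainComplex C ℤ} (f : K ⟶ L)
    (hf : DerivedCategory.Q.map f = 0) :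
    ∃ (K' : CochainComplex C ℤ) (s : K' ⟶ K), QuasiIso s ∧ Nonempty (Homotopy (s ≫ f) 0) := by
  have h : DerivedCategory.Qh.map ((HomotopyCategory.quotient C (.up ℤ)).map f) =
      DerivedCategory.Qh.map 0 := by
    have := DerivedCategory.quotientCompQhIso_hom_naturality f
    rw [hf, comp_zero] at this
    rw [Functor.map_zero]
    rwa [← cancel_mono ((DerivedCategory.quotientCompQhIso C).hom.app L), zero_comp]
  obtain ⟨K', s, hs, hsf⟩ := (MorphismProperty.map_eq_iff_precomp DerivedCategory.Qh
    (HomotopyCategory.quasiIso C (.up ℤ)) _ _).1 h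
  obtain ⟨K', rfl⟩ := HomotopyCategory.quotient_obj_surjective K'
  obtain ⟨s, rfl⟩ := (HomotopyCategory.quotient _ _).map_surjective s
  refine ⟨K', s, ?_, ⟨HomotopyCategory.homotopyOfEq _ _ ?_⟩⟩
  · rwa [HomotopyCategory.quotient_map_mem_quasiIso_iff,
      HomologicalComplex.mem_quasiIso_iff] at hs
  · rw [Functor.map_comp, hsf, comp_zero, Functor.map_zero]

variable {J : Type t} [HasColimitsOfShape (Discrete J) C]
  [HasExactColimitsOfShape (Discrete J) C]

omit [HasDerivedCategory.{w} C] in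
lemma quasiIso_sigmaMap {K L : J → CochainComplex C ℤ} (f : ∀ j, K j ⟶ L j)
    (hf : ∀ j, QuasiIso (f j)) : QuasiIso (Limits.Sigma.map f) :=
  quasiIso_colimMap _ fun j => hf j.as

/-- Coproducts in the derived category are computed by coproducts of complexes. -/
lemma isColimit_Q_sigma (K : J → CochainComplex C ℤ) :
    Nonempty (IsColimit (Cofan.mk (DerivedCategory.Q.obj (∐ K))
      fun j => DerivedCategory.Q.map (Sigma.ι K j))) := by
  -- Write `f` as a fraction with numerator `g`. Each component of `g` is null-homotopic after a
  -- quasi-isomorphism `t j`; the sum of the `t j` is again a quasi-isomorphism, and the homotopies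
  -- assemble.
  have uniq (L : CochainComplex C ℤ) (f : DerivedCategory.Q.obj (∐ K) ⟶ DerivedCategory.Q.obj L)
      (hf : ∀ j, DerivedCategory.Q.map (Sigma.ι K j) ≫ f = 0) : f = 0 := by
    obtain ⟨L', g, s, _, rfl⟩ := DerivedCategory.left_fac f
    have hg (j : J) : DerivedCategory.Q.map (Sigma.ι K j ≫ g) = 0 := by
      have := hf j
      rw [← assoc, ← Functor.map_comp] at this
      rwa [← cancel_mono (inv (DerivedCategory.Q.map s)), zero_comp]
    choose K' t ht h using fun j => exists_homotopy_of_Q_map_eq_zero _ (hg j)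
    have := quasiIso_sigmaMap t ht
    have H : Homotopy (Limits.Sigma.map t ≫ g) 0 :=
      Homotopy.ofIsColimitCofan (coproductIsCoproduct K') _ fun j =>
        (Homotopy.ofEq (by
          change Sigma.ι K' j ≫ _ = _
          rw [Limits.Sigma.ι_map_assoc])).trans (h j).some
    have h0 : DerivedCategory.Q.map (Limits.Sigma.map t ≫ g) = 0 := by
      rw [DerivedCategory.Q_map_eq_of_homotopy _ H, Functor.map_zero]
    rw [Functor.map_comp] at h0
    have : DerivedCategory.Q.map g = 0 := by
      rwa [← cancel_epi (DerivedCategory.Q.map (Limits.Sigma.map t)), comp_zero]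
    rw [this, zero_comp]
  -- The components are fractions with denominators on the source side, so the coproduct of the
  -- denominators is a common denominator.
  have ex (L : CochainComplex C ℤ) (f : ∀ j, DerivedCategory.Q.obj (K j) ⟶ DerivedCategory.Q.obj L) :
      ∃ g : DerivedCategory.Q.obj (∐ K) ⟶ DerivedCategory.Q.obj L,
        ∀ j, DerivedCategory.Q.map (Sigma.ι K j) ≫ g = f j := by
    choose K' t ht g hg using fun j => DerivedCategory.right_fac (f j)
    have := quasiIso_sigmaMap t fun j => (DerivedCategory.isIso_Q_map_iff_quasiIso C _).1 (ht j)
    refine ⟨inv (DerivedCategory.Q.map (Limits.Sigma.map t)) ≫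
      DerivedCategory.Q.map (Limits.Sigma.desc g), fun j => ?_⟩
    have := ht j
    have comm : DerivedCategory.Q.map (Sigma.ι K j) ≫
        inv (DerivedCategory.Q.map (Limits.Sigma.map t)) =
        inv (DerivedCategory.Q.map (t j)) ≫ DerivedCategory.Q.map (Sigma.ι K' j) := by
      rw [IsIso.comp_inv_eq, assoc, IsIso.eq_inv_comp, ← Functor.map_comp, ← Functor.map_comp,
        Limits.Sigma.ι_map]
    rw [hg, reassoc_of% comm, ← Functor.map_comp, Limits.Sigma.ι_desc]
  have ex' (Y : DerivedCategory C) (f : ∀ j, DerivedCategory.Q.obj (K j) ⟶ Y) :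
      ∃ g : DerivedCategory.Q.obj (∐ K) ⟶ Y,
        ∀ j, DerivedCategory.Q.map (Sigma.ι K j) ≫ g = f j := by
    let e := DerivedCategory.Q.objObjPreimageIso Y
    obtain ⟨g, hg⟩ := ex _ fun j => f j ≫ e.inv
    exact ⟨g ≫ e.hom, fun j => by rw [reassoc_of% (hg j), e.inv_hom_id, comp_id]⟩
  refine ⟨Cofan.IsColimit.mk _ (fun s => (ex' s.pt s.inj).choose)
    (fun s => (ex' s.pt s.inj).choose_spec) fun s m hm => ?_⟩
  let e := DerivedCategory.Q.objObjPreimageIso s.pt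
  rw [← cancel_mono e.inv, ← sub_eq_zero, ← Preadditive.sub_comp]
  refine uniq _ _ fun j => ?_
  have h₁ := hm j
  have h₂ := (ex' s.pt s.inj).choose_spec j
  change DerivedCategory.Q.map (Sigma.ι K j) ≫ m = _ at h₁
  rw [Preadditive.sub_comp, Preadditive.comp_sub, reassoc_of% h₁, reassoc_of% h₂, sub_self]

lemma prop_Q_sigma (P : ObjectProperty (DerivedCategory C))
    [P.IsClosedUnderColimitsOfShape (Discrete J)] (K : J → CochainComplex C ℤ)
    (hK : ∀ j, P (DerivedCategory.Q.obj (K j))) : P (DerivedCategory.Q.obj (∐ K)) :=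
  P.prop_of_isColimit (isColimit_Q_sigma K).some fun j => hK j.as

lemma isColimit_singleFunctor_sigma (M : J → C) (n : ℤ) :
    Nonempty (IsColimit (Cofan.mk ((DerivedCategory.singleFunctor C n).obj (∐ M))
      fun j => (DerivedCategory.singleFunctor C n).map (Sigma.ι M j))) := by
  let F := HomologicalComplex.single C (ComplexShape.up ℤ) n
  have h := (isColimit_Q_sigma fun j => F.obj (M j)).some
  let e : (∐ fun j => F.obj (M j)) ≅ F.obj (∐ M) := PreservesCoproduct.iso F M |>.symm
  refine ⟨IsColimit.ofIsoColimit h (Cofan.ext (DerivedCategory.Q.mapIso e) fun j => ?_)⟩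
  change DerivedCategory.Q.map _ ≫ DerivedCategory.Q.map e.hom = DerivedCategory.Q.map (F.map _)
  rw [← Functor.map_comp]
  congr 1
  simp [e]

end Coproducts

/-! ### Telescopes of sequences of modules and complexes -/

section Telescope

variable {S : Type u} [Ring S]

lemma exists_eq_sum_inj {A : ℕ → ModuleCat.{u} S} {s : Cofan A} (hs : IsColimit s) (x : s.pt) :
    ∃ (N : ℕ) (y : ∀ k, A k), (∀ k, N ≤ k → y k = 0) ∧
      x = ∑ k ∈ Finset.range N, s.inj k (y k) := by
  let h := ModuleCat.coproductCoconeIsColimit A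
  let e := h.coconePointUniqueUpToIso hs
  let ε : (DirectSum ℕ fun k => A k) →ₗ[S] s.pt := e.hom.hom
  have he (k : ℕ) (y : A k) : ε (DirectSum.lof S ℕ (fun k => A k) k y) = s.inj k y :=
    congr($(IsColimit.comp_coconePointUniqueUpToIso_hom h hs ⟨k⟩) y)
  obtain ⟨z, rfl⟩ : ∃ z, ε z = x := ⟨e.inv x, congr($(e.inv_hom_id) x)⟩
  induction z using DirectSum.induction_on with
  | zero => exact ⟨0, 0, by simp, by simp⟩
  | of i y =>
    refine ⟨i + 1, Pi.single i y, fun k hk => Pi.single_eq_of_ne (by lia) _, ?_⟩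
    rw [Finset.sum_range_succ, Finset.sum_eq_zero, zero_add, Pi.single_eq_same]
    · exact he i y
    · intro k hk
      rw [Finset.mem_range] at hk
      rw [Pi.single_eq_of_ne (by lia), map_zero]
  | add z₁ z₂ h₁ h₂ =>
    obtain ⟨N₁, y₁, hy₁, e₁⟩ := h₁
    obtain ⟨N₂, y₂, hy₂, e₂⟩ := h₂
    refine ⟨max N₁ N₂, y₁ + y₂, fun k hk => ?_, ?_⟩
    · simp [hy₁ k (le_trans (le_max_left _ _) hk), hy₂ k (le_trans (le_max_right _ _) hk)]
    · have aux (N M : ℕ) (hNM : N ≤ M) (y : ∀ k, A k) (hy : ∀ k, N ≤ k → y k = 0) :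
          ∑ k ∈ Finset.range N, s.inj k (y k) = ∑ k ∈ Finset.range M, s.inj k (y k) := by
        refine Finset.sum_subset (by simpa using hNM) fun k _ hk => ?_
        rw [hy k (by simpa using hk), map_zero]
      rw [map_add, e₁, e₂, aux N₁ _ (le_max_left _ _) y₁ hy₁,
        aux N₂ _ (le_max_right _ _) y₂ hy₂, ← Finset.sum_add_distrib]
      simp

/-- In components `f` is lower triangular with identities on the diagonal, so the components of a
kernel element vanish by induction. -/
lemma mono_of_telescope {A : ℕ → ModuleCat.{u} S} {s : Cofan A} (hs : IsColimit s)
    (a : ∀ k, A k ⟶ A (k + 1)) (f : s.pt ⟶ s.pt)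
    (hf : ∀ k, s.inj k ≫ f = s.inj k - a k ≫ s.inj (k + 1)) : Mono f := by
  let π (k : ℕ) : s.pt ⟶ A k := Cofan.IsColimit.desc hs fun j =>
    if h : j = k then eqToHom (by rw [h]) else 0
  have hπ (j k : ℕ) : s.inj j ≫ π k = if h : j = k then eqToHom (by rw [h]) else 0 :=
    Cofan.IsColimit.fac hs _ j
  have hπ' (k : ℕ) : s.inj k ≫ π k = 𝟙 _ := by simp [hπ]
  have hπ'' (j k : ℕ) (h : j ≠ k) : s.inj j ≫ π k = 0 := by simp [hπ, h]
  have h₀ : f ≫ π 0 = π 0 := Cofan.IsColimit.hom_ext hs _ _ fun k => by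
    rw [← assoc, hf, Preadditive.sub_comp, assoc, hπ'' (k + 1) 0 (by simp), comp_zero, sub_zero]
  have h₁ (l : ℕ) : f ≫ π (l + 1) = π (l + 1) - π l ≫ a l :=
    Cofan.IsColimit.hom_ext hs _ _ fun k => by
      rw [← assoc, hf, Preadditive.sub_comp, assoc, Preadditive.comp_sub]
      congr 1
      by_cases hk : k = l
      · subst hk
        rw [hπ', reassoc_of% hπ', comp_id]
      · rw [hπ'' _ _ (by simpa using hk), reassoc_of% hπ'' _ _ hk, comp_zero, zero_comp]
  rw [Preadditive.mono_iff_cancel_zero]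
  intro Z z hz
  have hz' (k : ℕ) : z ≫ π k = 0 := by
    induction k with
    | zero => rw [← h₀, reassoc_of% hz, zero_comp]
    | succ k hk =>
      have := z ≫= h₁ k
      rwa [reassoc_of% hz, zero_comp, Preadditive.comp_sub, reassoc_of% hk, zero_comp,
        sub_zero, eq_comm] at this
  ext t
  obtain ⟨N, y, hy, e⟩ := exists_eq_sum_inj hs (z t)
  have hy' (k : ℕ) : y k = 0 := by
    have h₂ : π k (z t) = 0 := congr($(hz' k) t)
    rw [e, map_sum] at h₂
    by_cases hk : k < N
    · rw [Finset.sum_eq_single k] at h₂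
      · rwa [← ModuleCat.comp_apply, hπ'] at h₂
      · intro j _ hj
        rw [← ModuleCat.comp_apply, hπ'' _ _ hj]
        rfl
      · simp [hk]
    · exact hy k (by simpa using hk)
  simp [e, hy']

/-- The telescope of a sequence of modules is a resolution of its colimit, under the assumption
that the elements of each stage which vanish in the colimit already vanish in the next stage. -/
lemma shortExact_telescope_moduleCat {A : ℕ → ModuleCat.{u} S} {s : Cofan A} (hs : IsColimit s)
    (a : ∀ k, A k ⟶ A (k + 1)) {B : ModuleCat.{u} S} (c : ∀ k, A k ⟶ B)
    (f : s.pt ⟶ s.pt) (g : s.pt ⟶ B) (w : f ≫ g = 0)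
    (hf : ∀ k, s.inj k ≫ f = s.inj k - a k ≫ s.inj (k + 1)) (hg : ∀ k, s.inj k ≫ g = c k)
    (hc : ∀ k, a k ≫ c (k + 1) = c k)
    (hsurj : ∀ b : B, ∃ k x, c k x = b) (hker : ∀ k x, c k x = 0 → a k x = 0) :
    (ShortComplex.mk f g w).ShortExact where
  mono_f := mono_of_telescope hs a f hf
  epi_g := by
    refine (ModuleCat.epi_iff_surjective _).2 fun b => ?_
    obtain ⟨k, x, rfl⟩ := hsurj b
    exact ⟨s.inj k x, congr($(hg k) x)⟩
  exact := by
    rw [ShortComplex.moduleCat_exact_iff]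
    intro x hx
    have hf' (k : ℕ) (z : A k) : f (s.inj k z) = s.inj k z - s.inj (k + 1) (a k z) :=
      congr($(hf k) z)
    have hg' (k : ℕ) (z : A k) : g (s.inj k z) = c k z := congr($(hg k) z)
    have hc' (k : ℕ) (z : A k) : c (k + 1) (a k z) = c k z := congr($(hc k) z)
    obtain ⟨N, x', hx', rfl⟩ := exists_eq_sum_inj hs x
    -- Forward substitution: `y k` is the image in `A k` of the first `k + 1` components of `x`.
    -- Cutting off at `N` leaves the error `a N (y N)`, which `hker` kills since `y N` dies in the
    -- colimit.
    let y (k : ℕ) : A k := Nat.rec (x' 0) (fun k z => x' (k + 1) + a k z) k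
    have hy₀ : y 0 = x' 0 := rfl
    have hy (k : ℕ) : y (k + 1) = x' (k + 1) + a k (y k) := rfl
    have hcy (k : ℕ) : c k (y k) = ∑ j ∈ Finset.range (k + 1), c j (x' j) := by
      induction k with
      | zero => simp [hy₀]
      | succ k hk => rw [hy, map_add, hc', hk, Finset.sum_range_succ _ (k + 1), add_comm]
    have hN : c N (y N) = 0 := by
      rw [hcy, Finset.sum_range_succ, hx' N le_rfl, map_zero, add_zero]
      change g _ = 0 at hx
      rw [map_sum] at hx
      simpa only [hg'] using hx
    have hfy (M : ℕ) : f (∑ k ∈ Finset.range (M + 1), s.inj k (y k)) =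
        ∑ k ∈ Finset.range (M + 1), s.inj k (x' k) - s.inj (M + 1) (a M (y M)) := by
      induction M with
      | zero => simp [hf', hy₀]
      | succ M hM =>
        rw [Finset.sum_range_succ, map_add, hM, hf', hy M, map_add, map_add, map_add,
          Finset.sum_range_succ _ (M + 1)]
        abel
    refine ⟨∑ k ∈ Finset.range (N + 1), s.inj k (y k), (hfy N).trans ?_⟩
    rw [hker _ _ hN, map_zero, sub_zero, Finset.sum_range_succ, hx' N le_rfl, map_zero, add_zero]

/-- The telescope of a sequence of complexes of modules. -/
lemma shortExact_telescope {ι : Type*} {d : ComplexShape ι}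
    {K : ℕ → HomologicalComplex (ModuleCat.{u} S) d} (a : ∀ k, K k ⟶ K (k + 1))
    {L : HomologicalComplex (ModuleCat.{u} S) d} (c : ∀ k, K k ⟶ L)
    (hc : ∀ k, a k ≫ c (k + 1) = c k)
    (hsurj : ∀ i (b : L.X i), ∃ k x, (c k).f i x = b)
    (hker : ∀ i k x, (c k).f i x = 0 → (a k).f i x = 0)
    (w : (𝟙 _ - Limits.Sigma.desc fun k => a k ≫ Sigma.ι K (k + 1)) ≫ Limits.Sigma.desc c = 0) :
    (ShortComplex.mk _ _ w).ShortExact := by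
  refine HomologicalComplex.shortExact_of_degreewise_shortExact _ fun i => ?_
  let s : Cofan fun k => (K k).X i := Cofan.mk ((∐ K).X i) fun k => (Sigma.ι K k).f i
  have hs : IsColimit s :=
    (isColimitMapCoconeCofanMkEquiv (HomologicalComplex.eval _ d i) K (Sigma.ι K))
      (isColimitOfPreserves (HomologicalComplex.eval _ d i) (coproductIsCoproduct K))
  refine shortExact_telescope_moduleCat hs (fun k => (a k).f i) (fun k => (c k).f i) _ _ _
    (fun k => ?_) (fun k => ?_) (fun k => ?_) (hsurj i) (hker i)
  · have : Sigma.ι K k ≫ (𝟙 _ - Limits.Sigma.desc fun k => a k ≫ Sigma.ι K (k + 1)) =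
        Sigma.ι K k - a k ≫ Sigma.ι K (k + 1) := by simp [Preadditive.comp_sub]
    exact congr_arg (fun φ => HomologicalComplex.Hom.f φ i) this
  · exact congr_arg (fun φ => HomologicalComplex.Hom.f φ i) (Sigma.ι_desc c k)
  · exact congr_arg (fun φ => HomologicalComplex.Hom.f φ i) (hc k)

end Telescope

/-! ### The filtration of a complex by degree -/

section Filtration

variable {S : Type u} [Ring S]

/-- The subcomplex of `K` which consists of the terms of degrees `≥ a`. -/
def stupidGE (K : CochainComplex (ModuleCat.{u} S) ℤ) (a : ℤ) :
    CochainComplex (ModuleCat.{u} S) ℤ where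
  X i := ModuleCat.of S ↥(if a ≤ i then ⊤ else ⊥ : Submodule S (K.X i))
  d i j := ModuleCat.ofHom ((K.d i j).hom.restrict fun x hx => by
    by_cases hij : i + 1 = j
    · by_cases h : a ≤ j
      · rw [if_pos h]
        trivial
      · rw [if_neg (by lia), Submodule.mem_bot] at hx
        rw [hx, map_zero]
        exact Submodule.zero_mem _
    · rw [K.shape i j hij]
      exact Submodule.zero_mem _)
  shape i j hij := by
    ext x
    change K.d i j x.1 = 0
    rw [K.shape i j hij]
    rfl
  d_comp_d' i j k _ _ := by
    ext x
    change (K.d i j ≫ K.d j k) x.1 = 0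
    rw [K.d_comp_d]
    rfl

/-- The inclusion of the subcomplex which consists of the terms of degrees `≥ a`. -/
def stupidGEι (K : CochainComplex (ModuleCat.{u} S) ℤ) (a : ℤ) : stupidGE K a ⟶ K where
  f _ := ModuleCat.ofHom (Submodule.subtype _)
  comm' _ _ _ := rfl

/-- The inclusions between the subcomplexes of terms of degrees `≥ a`. -/
def stupidGEMap (K : CochainComplex (ModuleCat.{u} S) ℤ) {a b : ℤ} (hab : b ≤ a) :
    stupidGE K a ⟶ stupidGE K b where
  f i := ModuleCat.ofHom (Submodule.inclusion (by
    split_ifs with h₁ h₂ h₂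
    · exact le_rfl
    · exact (h₂ (by lia)).elim
    · exact bot_le
    · exact le_rfl))
  comm' _ _ _ := rfl

lemma stupidGEι_injective (K : CochainComplex (ModuleCat.{u} S) ℤ) (a i : ℤ) :
    Function.Injective ((stupidGEι K a).f i) := Subtype.val_injective

lemma stupidGEι_surjective (K : CochainComplex (ModuleCat.{u} S) ℤ) (a i : ℤ) (h : a ≤ i) :
    Function.Surjective ((stupidGEι K a).f i) :=
  fun x => ⟨⟨x, by rw [if_pos h]; trivial⟩, rfl⟩

lemma stupidGE_eq_zero (K : CochainComplex (ModuleCat.{u} S) ℤ) (a i : ℤ) (h : i < a)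
    (x : (stupidGE K a).X i) : x = 0 := by
  obtain ⟨x, hx⟩ := x
  rw [if_neg (by lia), Submodule.mem_bot] at hx
  exact Subtype.ext hx

lemma stupidGEMap_comp_ι (K : CochainComplex (ModuleCat.{u} S) ℤ) {a b : ℤ} (hab : b ≤ a) :
    stupidGEMap K hab ≫ stupidGEι K b = stupidGEι K a := rfl

/-- The projection of the subcomplex of terms of degrees `≥ a` onto its term of degree `a`. -/
def stupidGEπ (K : CochainComplex (ModuleCat.{u} S) ℤ) (a : ℤ) :
    stupidGE K a ⟶ (CochainComplex.singleFunctor (ModuleCat.{u} S) a).obj (K.X a) :=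
  HomologicalComplex.mkHomToSingle ((stupidGEι K a).f a) fun i hi => by
    ext x
    rw [stupidGE_eq_zero K a i (by simp at hi; lia) x, map_zero, map_zero]

lemma isZero_moduleCat {M : ModuleCat.{u} S} (h : ∀ x : M, x = 0) : IsZero M := by
  have : Subsingleton M := ⟨fun x y => by rw [h x, h y]⟩
  exact ModuleCat.isZero_of_subsingleton M

lemma stupidGEMap_comp_π (K : CochainComplex (ModuleCat.{u} S) ℤ) (a : ℤ) :
    stupidGEMap K (show a ≤ a + 1 by lia) ≫ stupidGEπ K a = 0 :=
  HomologicalComplex.to_single_hom_ext <| by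
    ext x
    rw [stupidGE_eq_zero K (a + 1) a (by lia) x, map_zero, map_zero]

lemma shortExact_stupidGE (K : CochainComplex (ModuleCat.{u} S) ℤ) (a : ℤ) :
    (ShortComplex.mk _ _ (stupidGEMap_comp_π K a)).ShortExact := by
  refine HomologicalComplex.shortExact_of_degreewise_shortExact _ fun i => ?_
  have hinj : Function.Injective ((stupidGEMap K (show a ≤ a + 1 by lia)).f i) :=
    fun x y h => Subtype.val_injective (congr_arg (fun z : (stupidGE K a).X i => z.1) h)
  have hm := (ModuleCat.mono_iff_injective _).2 hinj
  by_cases hi : i = a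
  · subst hi
    have : (stupidGEπ K i).f i = (stupidGEι K i).f i ≫
        (HomologicalComplex.singleObjXSelf (.up ℤ) i (K.X i)).inv :=
      HomologicalComplex.mkHomToSingle_f _ _
    have := (ModuleCat.mono_iff_injective _).2 (stupidGEι_injective K i i)
    have := (ModuleCat.epi_iff_surjective _).2 (stupidGEι_surjective K i i le_rfl)
    have hiso : IsIso ((stupidGEι K i).f i) := isIso_of_mono_of_epi _
    have : IsIso ((stupidGEπ K i).f i) := by
      rw [‹(stupidGEπ K i).f i = _›]
      exact IsIso.comp_isIso' hiso (Iso.isIso_inv _)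
    have hz : IsZero ((stupidGE K (i + 1)).X i) :=
      isZero_moduleCat (stupidGE_eq_zero K (i + 1) i (by lia))
    refine ShortComplex.ShortExact.mk' ?_ hm ?_
    · refine (ShortComplex.exact_iff_mono _ (hz.eq_of_src _ _)).2 ?_
      change Mono ((stupidGEπ K i).f i)
      infer_instance
    · change Epi ((stupidGEπ K i).f i)
      infer_instance
  · have hz : IsZero (((CochainComplex.singleFunctor (ModuleCat.{u} S) a).obj (K.X a)).X i) :=
      HomologicalComplex.isZero_single_obj_X _ _ _ _ hi
    refine ShortComplex.ShortExact.mk' ?_ hm ?_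
    · refine (ShortComplex.exact_iff_epi _ (hz.eq_of_tgt _ _)).2 ?_
      refine (ModuleCat.epi_iff_surjective _).2 fun x => ?_
      by_cases h : a ≤ i
      · refine ⟨⟨x.1, ?_⟩, rfl⟩
        rw [if_pos (by lia)]
        trivial
      · exact ⟨0, by rw [map_zero]; exact (stupidGE_eq_zero K a i (by lia) x).symm⟩
    · exact ⟨fun _ _ _ => hz.eq_of_src _ _⟩

end Filtration

/-! ### Closure properties of cocomplete suspended subcategories -/

section SuspendedGeneral

variable {C : Type u} [Category.{v} C] [Preadditive C] [HasZeroObject C] [HasShift C ℤ]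
  [∀ (n : ℤ), (shiftFunctor C n).Additive] [Pretriangulated C]

namespace IsCocompleteSuspended

variable {P : ObjectProperty C} (hP : IsCocompleteSuspended.{t} P)

include hP

/-- Any object isomorphic to `X` is a coproduct of the one-member family `X`. -/
lemma isClosedUnderIsomorphisms : P.IsClosedUnderIsomorphisms where
  of_iso {X Y} e hX := by
    have := hP.coprod PUnit
    exact P.prop_of_isColimit (J := Discrete PUnit.{t + 1}) (F := Discrete.functor fun _ => X)
      (c := Cofan.mk Y fun _ => e.hom)
      (Cofan.IsColimit.mk _ (fun s => e.inv ≫ s.inj ⟨⟩)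
        (fun s j => e.hom_inv_id_assoc _)
        (fun s m hm => by rw [← hm ⟨⟩]; simp)) fun _ => hX

lemma prop_of_iso {X Y : C} (e : X ≅ Y) (h : P X) : P Y :=
  hP.isClosedUnderIsomorphisms.of_iso e h

lemma isClosedUnderColimitsOfShape_nat : P.IsClosedUnderColimitsOfShape (Discrete ℕ) := by
  have := hP.coprod (ULift.{t} ℕ)
  exact .of_equivalence (P := P) (Discrete.equivalence Equiv.ulift)

lemma prop_of_isZero {X : C} (hX : IsZero X) : P X := by
  have := hP.coprod PEmpty
  exact P.prop_of_isColimit (J := Discrete PEmpty.{t + 1})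
    (F := Discrete.functor fun _ => X) (c := Cofan.mk X fun _ => 𝟙 X)
    (Cofan.IsColimit.mk _ (fun s => 0) (fun s j => j.elim) (fun s m _ => hX.eq_of_src _ _))
    fun j => j.as.elim

lemma prop_shift_nat (X : C) (hX : P X) (n : ℕ) : P (X⟦(n : ℤ)⟧) := by
  induction n with
  | zero => exact hP.prop_of_iso ((shiftFunctorZero' C _ rfl).symm.app X) hX
  | succ n hn =>
    exact hP.prop_of_iso ((shiftFunctorAdd' C (n : ℤ) 1 _ (by simp)).symm.app X) (hP.shift _ hn)

lemma prop_shift (X : C) (hX : P X) (n : ℤ) (hn : 0 ≤ n) : P (X⟦n⟧) := by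
  obtain ⟨n, rfl⟩ := Int.eq_ofNat_of_zero_le hn
  exact hP.prop_shift_nat X hX n

lemma prop₃ (Δ : Triangle C) (hΔ : Δ ∈ distTriang C) (h₁ : P Δ.obj₁) (h₂ : P Δ.obj₂) :
    P Δ.obj₃ :=
  hP.ext _ (rot_of_distTriang _ hΔ) h₂ (hP.shift _ h₁)

/-- Reduces statements about shifts to unshifted ones: as R[n] is in U, the class of X with X[n] in
U contains R, hence all of D^{≤ 0}. -/
lemma inverseImage_shift (n : ℤ) :
    IsCocompleteSuspended.{t} (P.inverseImage (shiftFunctor C n)) where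
  ext Δ hΔ h₁ h₃ := hP.ext _ (Triangle.shift_distinguished _ hΔ n) h₁ h₃
  shift X hX := hP.prop_of_iso ((shiftFunctorComm C n 1).app X) (hP.shift _ hX)
  coprod J := by
    have := hP.coprod J
    infer_instance

end IsCocompleteSuspended

lemma isCocompleteSuspended_susp (E : C) : IsCocompleteSuspended.{t} (susp.{t} E) where
  ext Δ hΔ h₁ h₃ P hP hE := hP.ext Δ hΔ (h₁ P hP hE) (h₃ P hP hE)
  shift X hX P hP hE := hP.shift X (hX P hP hE)
  coprod J :=
    { colimitsOfShape_le := by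
        rintro X ⟨p⟩ P hP hE
        have := hP.coprod J
        exact P.prop_of_isColimit p.isColimit fun j => p.prop_diag_obj j P hP hE }

lemma susp_self (E : C) : susp.{t} E E := fun _ _ hE => hE

end SuspendedGeneral

/-! ### Generating the natural aisle from the ring -/

section Modules

variable {S : Type u} [Ring S] [HasDerivedCategory.{w} (ModuleCat.{u} S)]

open DerivedCategory ZeroObject

variable {P : ObjectProperty (DerivedCategory (ModuleCat.{u} S))}

/-- The colimit of a sequence of complexes, as in `shortExact_telescope`, belongs to
any cocomplete suspended subcategory which contains the sequence. -/
lemma IsCocompleteSuspended.prop_Q_of_telescope (hP : IsCocompleteSuspended.{u} P)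
    {K : ℕ → CochainComplex (ModuleCat.{u} S) ℤ} (a : ∀ k, K k ⟶ K (k + 1))
    {L : CochainComplex (ModuleCat.{u} S) ℤ} (c : ∀ k, K k ⟶ L)
    (hc : ∀ k, a k ≫ c (k + 1) = c k)
    (hsurj : ∀ i (b : L.X i), ∃ k x, (c k).f i x = b)
    (hker : ∀ i k x, (c k).f i x = 0 → (a k).f i x = 0)
    (hK : ∀ k, P (Q.obj (K k))) : P (Q.obj L) := by
  have := hP.isClosedUnderColimitsOfShape_nat
  have h := shortExact_telescope a c hc hsurj hker (Limits.Sigma.hom_ext _ _ fun k => by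
    rw [Preadditive.sub_comp, Preadditive.comp_sub, Limits.Sigma.ι_desc_assoc, id_comp, assoc,
      Limits.Sigma.ι_desc, Limits.Sigma.ι_desc, hc, sub_self, comp_zero])
  exact hP.prop₃ _ (triangleOfSES_distinguished h) (prop_Q_sigma P K hK) (prop_Q_sigma P K hK)

/-- A property of objects which is closed under extensions and contains the terms of a complex
also contains its subcomplexes of terms of degrees `≥ a`, if the complex is bounded above. -/
lemma prop_Q_stupidGE (hP : ∀ Δ ∈ distTriang _, P Δ.obj₁ → P Δ.obj₃ → P Δ.obj₂)
    (hP₀ : ∀ X, IsZero X → P X)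
    (K : CochainComplex (ModuleCat.{u} S) ℤ) (b : ℤ) [K.IsStrictlyLE b]
    (hK : ∀ i, P ((singleFunctor _ i).obj (K.X i))) (k : ℕ) :
    P (Q.obj (stupidGE K (b + 1 - k))) := by
  induction k with
  | zero =>
    refine hP₀ _ (Q.map_isZero ?_)
    rw [IsZero.iff_id_eq_zero]
    ext i x
    by_cases hi : i ≤ b
    · exact (stupidGE_eq_zero K _ i (by simpa using by lia) _).trans
        (stupidGE_eq_zero K _ i (by simpa using by lia) _).symm
    · refine stupidGEι_injective K _ i ?_
      have := ModuleCat.subsingleton_of_isZero (K.isZero_of_isStrictlyLE b i (by lia))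
      exact Subsingleton.elim _ _
  | succ k hk =>
    have h := shortExact_stupidGE K (b - k)
    have e : b + 1 - (k : ℤ) = b - k + 1 := by lia
    have e' : b + 1 - ((k + 1 : ℕ) : ℤ) = b - k := by push_cast; lia
    rw [e] at hk
    rw [e']
    exact hP _ (triangleOfSES_distinguished h) hk (hK _)

/-- A bounded complex is a finite iterated extension of its terms. Neither shifts nor coproducts are
required of `P`, so this also applies to classes such as `HomVanish · Z`. -/
lemma prop_Q_of_isStrictlyGE_of_isStrictlyLE
    (hP : ∀ Δ ∈ distTriang _, P Δ.obj₁ → P Δ.obj₃ → P Δ.obj₂)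
    (hP₀ : ∀ X, IsZero X → P X)
    (K : CochainComplex (ModuleCat.{u} S) ℤ) (a b : ℤ) [K.IsStrictlyGE a] [K.IsStrictlyLE b]
    (hK : ∀ i, P ((singleFunctor _ i).obj (K.X i))) : P (Q.obj K) := by
  -- The threshold is `a` if `a ≤ b + 1`; otherwise it is `b + 1` and `K` is zero. Either way the
  -- inclusion into `K` is an isomorphism.
  have := prop_Q_stupidGE hP hP₀ K b hK (b + 1 - a).toNat
  have hiso (i : ℤ) : IsIso ((stupidGEι K (b + 1 - (b + 1 - a).toNat)).f i) := by
    have h₁ := (ModuleCat.mono_iff_injective _).2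
      (stupidGEι_injective K (b + 1 - (b + 1 - a).toNat) i)
    have h₂ : Epi ((stupidGEι K (b + 1 - (b + 1 - a).toNat)).f i) := by
      by_cases hi : a ≤ i ∧ i ≤ b
      · exact (ModuleCat.epi_iff_surjective _).2 (stupidGEι_surjective K _ i (by lia))
      · refine ⟨fun _ _ _ => IsZero.eq_of_src ?_ _ _⟩
        by_cases hi' : a ≤ i
        · exact K.isZero_of_isStrictlyLE b i (by lia)
        · exact K.isZero_of_isStrictlyGE a i (by lia)
    exact isIso_of_mono_of_epi _
  have := HomologicalComplex.Hom.isIso_of_components (stupidGEι K (b + 1 - (b + 1 - a).toNat))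
  have hP' : P.IsClosedUnderIsomorphisms := ⟨fun {X Y} e hX =>
    hP (Triangle.mk e.hom (0 : Y ⟶ 0) 0)
      ((Triangle.distinguished_iff_of_isZero₃ _ (isZero_zero _)).2 e.isIso_hom) hX
      (hP₀ _ (isZero_zero _))⟩
  exact P.prop_of_iso (asIso (Q.map (stupidGEι K (b + 1 - (b + 1 - a).toNat)))) ‹_›

/-- The complex is the increasing union of its bounded subcomplexes of degrees ≥ b + 1 - k, and the
telescope passes to the union. -/
lemma IsCocompleteSuspended.prop_Q_of_isStrictlyLE (hP : IsCocompleteSuspended.{u} P)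
    (K : CochainComplex (ModuleCat.{u} S) ℤ) (b : ℤ) [K.IsStrictlyLE b]
    (hK : ∀ i, P ((singleFunctor _ i).obj (K.X i))) : P (Q.obj K) := by
  refine hP.prop_Q_of_telescope (K := fun k => stupidGE K (b + 1 - k))
    (fun k => stupidGEMap K (by push_cast; lia)) (fun k => stupidGEι K _)
    (fun k => stupidGEMap_comp_ι K _) (fun i y => ?_) (fun i k x hx => ?_)
    (prop_Q_stupidGE hP.ext (fun _ => hP.prop_of_isZero) K b hK)
  · obtain ⟨k, hk⟩ : ∃ k : ℕ, b + 1 - k ≤ i := ⟨(b + 1 - i).toNat, by lia⟩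
    exact ⟨k, stupidGEι_surjective K _ i hk y⟩
  · have : x = 0 := stupidGEι_injective K _ i (hx.trans (map_zero _).symm)
    rw [this, map_zero]

/-- `M` is the colimit of N → N → ⋯ along the idempotent `r.r ≫ r.i`, whose kernel is that of `r.r`;
so the telescope applies. -/
lemma IsCocompleteSuspended.prop_single_of_retract (hP : IsCocompleteSuspended.{u} P) (n : ℤ)
    {M N : ModuleCat.{u} S} (r : Retract M N) (hN : P ((singleFunctor _ n).obj N)) :
    P ((singleFunctor _ n).obj M) := by
  let F := CochainComplex.singleFunctor (ModuleCat.{u} S) n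
  refine hP.prop_Q_of_telescope (K := fun _ => F.obj N) (L := F.obj M)
    (fun _ => F.map (r.r ≫ r.i)) (fun _ => F.map r.r) (fun _ => by simp [← Functor.map_comp])
    (fun i b => ⟨0, (F.map r.i).f i b, ?_⟩) (fun i _ x hx => ?_) fun _ => hN
  · have : F.map r.i ≫ F.map r.r = 𝟙 _ := by
      rw [← Functor.map_comp, r.retract, CategoryTheory.Functor.map_id]
    exact congr(HomologicalComplex.Hom.f $this i b)
  · rw [Functor.map_comp]
    change (F.map r.i).f i ((F.map r.r).f i x) = 0
    rw [hx, map_zero]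

lemma IsCocompleteSuspended.prop_single (hP : IsCocompleteSuspended.{u} P)
    {M : ModuleCat.{u} S} (hM : P ((singleFunctor _ 0).obj M)) (i : ℤ) (hi : i ≤ 0) :
    P ((singleFunctor _ i).obj M) :=
  hP.prop_of_iso (((singleFunctors (ModuleCat.{u} S)).shiftIso (-i) i 0 (by lia)).app M)
    (hP.prop_shift _ hM (-i) (by lia))

lemma IsCocompleteSuspended.prop_Q_of_isStrictlyLE_zero (hP : IsCocompleteSuspended.{u} P)
    (K : CochainComplex (ModuleCat.{u} S) ℤ) [K.IsStrictlyLE 0]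
    (hK : ∀ i, P ((singleFunctor _ 0).obj (K.X i))) : P (Q.obj K) := by
  refine hP.prop_Q_of_isStrictlyLE K 0 fun i => ?_
  by_cases hi : i ≤ 0
  · exact hP.prop_single (hK i) i hi
  · exact hP.prop_of_isZero (Functor.map_isZero _ (K.isZero_of_isStrictlyLE 0 i (by lia)))

lemma IsCocompleteSuspended.prop_single_sigma (hP : IsCocompleteSuspended.{u} P)
    {J : Type u} (M : J → ModuleCat.{u} S) (n : ℤ)
    (hM : ∀ j, P ((singleFunctor _ n).obj (M j))) : P ((singleFunctor _ n).obj (∐ M)) := by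
  have := hP.coprod J
  exact P.prop_of_isColimit (isColimit_singleFunctor_sigma M n).some fun j => hM j.as

lemma IsCocompleteSuspended.prop_single_of_projective (hP : IsCocompleteSuspended.{u} P)
    (hS : P ((singleFunctor _ 0).obj (ModuleCat.of S S))) (M : ModuleCat.{u} S) [Projective M] :
    P ((singleFunctor _ 0).obj M) := by
  let f : (∐ fun _ : M => ModuleCat.of S S) ⟶ M :=
    Limits.Sigma.desc fun x => ModuleCat.ofHom (LinearMap.toSpanSingleton S M x)
  have : Epi f := (ModuleCat.epi_iff_surjective _).2 fun x => by
    have h : Sigma.ι (fun _ : M => ModuleCat.of S S) x ≫ f =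
      ModuleCat.ofHom (LinearMap.toSpanSingleton S M x) := Limits.Sigma.ι_desc _ _
    refine ⟨Sigma.ι (fun _ : M => ModuleCat.of S S) x (1 : S), ?_⟩
    exact congr($h (1 : S)).trans (one_smul S x)
  exact hP.prop_single_of_retract 0
    ⟨Projective.factorThru (𝟙 M) f, f, Projective.factorThru_comp _ _⟩
    (hP.prop_single_sigma _ 0 fun _ => hS)

/-- A cocomplete suspended subcategory of the derived category which contains the ring
also contains all the modules. -/
lemma IsCocompleteSuspended.prop_single_module (hP : IsCocompleteSuspended.{u} P)
    (hS : P ((singleFunctor _ 0).obj (ModuleCat.of S S))) (M : ModuleCat.{u} S) :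
    P ((singleFunctor _ 0).obj M) := by
  let p := ProjectiveResolution.of M
  have : IsIso (Q.map p.π') := (isIso_Q_map_iff_quasiIso _ _).2 inferInstance
  let e : Q.obj p.cochainComplex ≅
    Q.obj ((CochainComplex.singleFunctor (ModuleCat.{u} S) 0).obj M) := asIso (Q.map p.π')
  exact hP.prop_of_iso (Y := (singleFunctor _ 0).obj M) e
    (hP.prop_Q_of_isStrictlyLE_zero p.cochainComplex fun i => hP.prop_single_of_projective hS _)

/-- A cocomplete suspended subcategory of the derived category which contains the ring
also contains the aisle of the natural t-structure. -/
lemma IsCocompleteSuspended.prop_of_isLE_zero (hP : IsCocompleteSuspended.{u} P)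
    (hS : P ((singleFunctor _ 0).obj (ModuleCat.of S S)))
    (X : DerivedCategory (ModuleCat.{u} S)) [X.IsLE 0] : P X := by
  obtain ⟨K, _, ⟨e⟩⟩ := X.exists_iso_Q_obj_of_isLE 0
  exact hP.prop_of_iso e.symm
    (hP.prop_Q_of_isStrictlyLE_zero K fun i => hP.prop_single_module hS _)

end Modules

/-! ### Morphisms out of a projective resolution -/

section KProjective

open DerivedCategory

variable {C : Type*} [Category* C] [Abelian C] [HasDerivedCategory.{w} C]

lemma Q_map_surjective_of_isKProjective (K L : CochainComplex C ℤ) [K.IsKProjective]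
    (f : Q.obj K ⟶ Q.obj L) : ∃ g : K ⟶ L, Q.map g = f := by
  obtain ⟨g, hg⟩ := (CochainComplex.IsKProjective.Qh_map_bijective K
    ((HomotopyCategory.quotient _ _).obj L)).surjective
      ((quotientCompQhIso C).hom.app K ≫ f ≫ (quotientCompQhIso C).inv.app L)
  obtain ⟨g, rfl⟩ := (HomotopyCategory.quotient _ _).map_surjective g
  refine ⟨g, ?_⟩
  have := quotientCompQhIso_hom_naturality g
  rw [hg] at this
  simpa using this.symm

/-- The isomorphism in the derived category given by a projective resolution. -/
def qCochainComplexIso {T : C} (p : ProjectiveResolution T) :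
    Q.obj p.cochainComplex ≅ (singleFunctor C 0).obj T :=
  have : IsIso (Q.map p.π') := (isIso_Q_map_iff_quasiIso _ _).2 inferInstance
  show Q.obj p.cochainComplex ≅ Q.obj ((CochainComplex.singleFunctor C 0).obj T) from
    asIso (Q.map p.π')

/-- Such a morphism is represented by a chain map from a complex living in degrees -n, …, 0 to one
living in degrees ≤ -n - 1. -/
lemma eq_zero_of_projectiveResolution {T : C} (p : ProjectiveResolution T) (n : ℕ)
    (hp : ∀ i, n < i → IsZero (p.complex.X i)) (X : DerivedCategory C) [X.IsLE (-n - 1)]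
    (f : (singleFunctor C 0).obj T ⟶ X) : f = 0 := by
  obtain ⟨K, _, ⟨e⟩⟩ := X.exists_iso_Q_obj_of_isLE (-n - 1)
  obtain ⟨g, hg⟩ := Q_map_surjective_of_isKProjective p.cochainComplex K
    ((qCochainComplexIso p).hom ≫ f ≫ e.hom)
  have : g = 0 := by
    ext i
    by_cases hi : -n - 1 < i
    · exact (K.isZero_of_isStrictlyLE _ i hi).eq_of_tgt _ _
    · exact ((hp (-i).toNat (by lia)).of_iso
        (p.cochainComplexXIso i (-i).toNat (by lia))).eq_of_src _ _
  rw [this, Functor.map_zero, eq_comm] at hg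
  rwa [← cancel_epi (qCochainComplexIso p).hom, ← cancel_mono e.hom, assoc, comp_zero, zero_comp]

end KProjective

/-! ### Homology detected by maps from the ring -/

section Homology

open DerivedCategory

variable {S : Type u} [Ring S] [HasDerivedCategory.{w} (ModuleCat.{u} S)]

/-- A cycle of degree `i` is the image of 1 under a chain map from `S` placed in degree `i`; if this
map vanishes in the derived category, the class of the cycle vanishes. -/
lemma isZero_homology_of_forall_eq_zero (X : DerivedCategory (ModuleCat.{u} S)) (i : ℤ)
    (h : ∀ f : (singleFunctor _ i).obj (ModuleCat.of S S) ⟶ X, f = 0) :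
    IsZero ((homologyFunctor _ i).obj X) := by
  let K := Q.objPreimage X
  let e : Q.obj K ≅ X := Q.objObjPreimageIso X
  refine IsZero.of_iso ?_ ((homologyFunctor _ i).mapIso e.symm ≪≫
    (homologyFunctorFactors _ i).app K)
  change IsZero (K.homology i)
  have key (ψ : ModuleCat.of S S ⟶ K.cycles i) : ψ ≫ K.homologyπ i = 0 := by
    let g : (HomologicalComplex.single (ModuleCat.{u} S) (.up ℤ) i).obj (ModuleCat.of S S) ⟶ K :=
      HomologicalComplex.mkHomFromSingle (ψ ≫ K.iCycles i) fun k _ => by simp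
    have hg : Q.map g = 0 := by
      have := h (Q.map g ≫ e.hom)
      rwa [← cancel_mono e.hom, zero_comp]
    have hg' : HomologicalComplex.homologyMap g i = 0 := by
      have h₁ := (homologyFunctorFactors (ModuleCat.{u} S) i).hom.naturality g
      have h₂ : (Q ⋙ homologyFunctor (ModuleCat.{u} S) i).map g = 0 := by
        rw [Functor.comp_map, hg, Functor.map_zero]
      rw [h₂, zero_comp] at h₁
      exact (cancel_epi ((homologyFunctorFactors (ModuleCat.{u} S) i).hom.app _)).1
        (h₁.symm.trans comp_zero.symm)
    let z : ModuleCat.of S S ⟶ ((HomologicalComplex.single (ModuleCat.{u} S) (.up ℤ) i).obj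
        (ModuleCat.of S S)).cycles i :=
      HomologicalComplex.liftCycles _ (HomologicalComplex.singleObjXSelf (.up ℤ) i _).inv _ rfl
        (by simp)
    have hz : z ≫ HomologicalComplex.cyclesMap g i = ψ := by
      rw [← cancel_mono (K.iCycles i), assoc, HomologicalComplex.cyclesMap_i]
      simp [z, g]
    rw [← hz, assoc, ← HomologicalComplex.homologyπ_naturality, hg', comp_zero, comp_zero]
  refine isZero_moduleCat fun x => ?_
  obtain ⟨y, rfl⟩ := (ModuleCat.epi_iff_surjective (K.homologyπ i)).1 inferInstance x
  have := key (ModuleCat.ofHom (LinearMap.toSpanSingleton S (K.cycles i) y))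
  have : K.homologyπ i ((1 : S) • y) = 0 := congr($this (1 : S))
  rwa [one_smul] at this

lemma isZero_homology_of_single (X : DerivedCategory (ModuleCat.{u} S)) (i : ℤ)
    (h : ∀ f : (singleFunctor _ 0).obj (ModuleCat.of S S) ⟶ X⟦i⟧, f = 0) :
    IsZero ((homologyFunctor _ i).obj X) := by
  refine isZero_homology_of_forall_eq_zero X i fun f => ?_
  apply (shiftFunctor (DerivedCategory (ModuleCat.{u} S)) i).map_injective
  rw [Functor.map_zero, ← cancel_epi
    (((singleFunctors (ModuleCat.{u} S)).shiftIso i 0 i (by lia)).inv.app _), comp_zero]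
  exact h _

end Homology

/-! ### Vanishing of morphisms and reduction along triangles -/

section HomVanish

variable {C : Type u} [Category.{v} C] [Preadditive C]

/-- All morphisms from `A` to `B` are zero. -/
def HomVanish (A B : C) : Prop := ∀ f : A ⟶ B, f = 0

lemma HomVanish.of_iso_left {A A' B : C} (h : HomVanish A B) (e : A ≅ A') : HomVanish A' B :=
  fun f => by rw [← cancel_epi e.hom, h (e.hom ≫ f), comp_zero]

lemma HomVanish.of_iso_right {A B B' : C} (h : HomVanish A B) (e : B ≅ B') : HomVanish A B' :=
  fun f => by rw [← cancel_mono e.inv, h (f ≫ e.inv), zero_comp]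

lemma HomVanish.of_retract_left {A A' B : C} (h : HomVanish A B) (r : Retract A' A) :
    HomVanish A' B :=
  fun f => by rw [← id_comp f, ← r.retract, assoc, h (r.r ≫ f), comp_zero]

lemma HomVanish.of_retract_right {A B B' : C} (h : HomVanish A B) (r : Retract B' B) :
    HomVanish A B' :=
  fun f => by rw [← comp_id f, ← r.retract, ← assoc, h (f ≫ r.i), zero_comp]

lemma HomVanish.of_isZero_left {A : C} (B : C) (hA : IsZero A) : HomVanish A B :=
  fun _ => hA.eq_of_src _ _

lemma isClosedUnderColimitsOfShape_homVanish (B : C) (J : Type t) :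
    ObjectProperty.IsClosedUnderColimitsOfShape (fun A => HomVanish A B) (Discrete J) where
  colimitsOfShape_le := by
    rintro X ⟨p⟩ f
    exact p.isColimit.hom_ext fun j => by rw [comp_zero]; exact p.prop_diag_obj j _

section Shift

variable [HasShift C ℤ]

lemma HomVanish.shift_add_iff {A B : C} (a b c : ℤ) (h : a + b = c) :
    HomVanish A (B⟦c⟧) ↔ HomVanish A ((B⟦a⟧)⟦b⟧) :=
  ⟨fun H => H.of_iso_right ((shiftFunctorAdd' C a b c h).app B),
    fun H => H.of_iso_right ((shiftFunctorAdd' C a b c h).symm.app B)⟩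

lemma HomVanish.shift_zero_iff {A B : C} : HomVanish A (B⟦(0 : ℤ)⟧) ↔ HomVanish A B :=
  ⟨fun H => H.of_iso_right ((shiftFunctorZero C ℤ).app B),
    fun H => H.of_iso_right ((shiftFunctorZero C ℤ).symm.app B)⟩

variable [∀ (n : ℤ), (shiftFunctor C n).Additive]

lemma HomVanish.shift_left_iff {A B : C} (a b c : ℤ) (h : b + a = c) :
    HomVanish (A⟦a⟧) (B⟦c⟧) ↔ HomVanish A (B⟦b⟧) := by
  rw [HomVanish.shift_add_iff b a c h]
  refine ⟨fun H f => (shiftFunctor C a).map_injective ?_, fun H f => ?_⟩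
  · rw [Functor.map_zero]
    exact H _
  · obtain ⟨g, rfl⟩ := (shiftFunctor C a).map_surjective f
    rw [H g, Functor.map_zero]

end Shift

variable [HasZeroObject C] [HasShift C ℤ]
  [∀ (n : ℤ), (shiftFunctor C n).Additive] [Pretriangulated C]

lemma HomVanish.obj₂ {A : C} {Δ : Triangle C} (hΔ : Δ ∈ distTriang C)
    (h₁ : HomVanish A Δ.obj₁) (h₃ : HomVanish A Δ.obj₃) : HomVanish A Δ.obj₂ := fun f => by
  obtain ⟨g, rfl⟩ := Triangle.coyoneda_exact₂ Δ hΔ f (h₃ _)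
  rw [h₁ g, zero_comp]

lemma HomVanish.obj₂_left {B : C} {Δ : Triangle C} (hΔ : Δ ∈ distTriang C)
    (h₁ : HomVanish Δ.obj₁ B) (h₃ : HomVanish Δ.obj₃ B) : HomVanish Δ.obj₂ B := fun f => by
  obtain ⟨g, rfl⟩ := Triangle.yoneda_exact₂ Δ hΔ f (h₁ _)
  rw [h₃ g, comp_zero]

lemma HomVanish.shift_obj₂ {A : C} {Δ : Triangle C} (hΔ : Δ ∈ distTriang C) (i : ℤ)
    (h₁ : HomVanish A (Δ.obj₁⟦i⟧)) (h₃ : HomVanish A (Δ.obj₃⟦i⟧)) :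
    HomVanish A (Δ.obj₂⟦i⟧) :=
  HomVanish.obj₂ (Triangle.shift_distinguished _ hΔ i) h₁ h₃

lemma HomVanish.shift_obj₃ {A : C} {Δ : Triangle C} (hΔ : Δ ∈ distTriang C) (i j : ℤ)
    (h : i + 1 = j) (h₂ : HomVanish A (Δ.obj₂⟦i⟧)) (h₁ : HomVanish A (Δ.obj₁⟦j⟧)) :
    HomVanish A (Δ.obj₃⟦i⟧) :=
  HomVanish.shift_obj₂ (rot_of_distTriang _ hΔ) i h₂
    ((HomVanish.shift_add_iff 1 i j (by lia)).1 h₁)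

lemma HomVanish.shift_obj₁ {A : C} {Δ : Triangle C} (hΔ : Δ ∈ distTriang C) (i j : ℤ)
    (h : j + 1 = i) (h₃ : HomVanish A (Δ.obj₃⟦j⟧)) (h₂ : HomVanish A (Δ.obj₂⟦i⟧)) :
    HomVanish A (Δ.obj₁⟦i⟧) :=
  HomVanish.shift_obj₂ (inv_rot_of_distTriang _ hΔ) i
    ((HomVanish.shift_add_iff (-1) i j (by lia)).1 h₃) h₂

/-- The objects without nonzero morphisms to the shifts `B⟦i⟧`, `i ≤ 0`, form a cocomplete
suspended subcategory. -/
lemma isCocompleteSuspended_homVanish (B : C) :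
    IsCocompleteSuspended.{t} (C := C) fun X => ∀ i : ℤ, i ≤ 0 → HomVanish X (B⟦i⟧) where
  ext Δ hΔ h₁ h₃ i hi := HomVanish.obj₂_left hΔ (h₁ i hi) (h₃ i hi)
  shift X hX i hi := (HomVanish.shift_left_iff 1 (i - 1) i (by lia)).2 (hX _ (by lia))
  coprod J :=
    { colimitsOfShape_le := by
        rintro X ⟨p⟩ i hi
        have := isClosedUnderColimitsOfShape_homVanish (B⟦i⟧) J
        exact ObjectProperty.prop_of_isColimit (P := fun A => HomVanish A (B⟦i⟧))
          p.isColimit fun j => p.prop_diag_obj j i hi }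

/-- If `X` is in the cocomplete suspended subcategory generated by `E`, and there is no
nonzero morphism from `E` to `Y⟦i⟧` for `i ≤ 0`, then there is none from `X` to `Y`. -/
lemma homVanish_of_susp {E X Y : C} (hX : susp.{t} E X)
    (hY : ∀ i : ℤ, i ≤ 0 → HomVanish E (Y⟦i⟧)) : HomVanish X Y :=
  HomVanish.shift_zero_iff.1
    (hX _ (isCocompleteSuspended_homVanish Y) hY 0 le_rfl)

/-- `Y` is a cone of a morphism from an object which satisfies `V` to `X`. -/
def ReducesTo (V : ObjectProperty C) (X Y : C) : Prop :=
  ∃ (F : C) (f : F ⟶ X) (g : X ⟶ Y) (h : Y ⟶ F⟦(1 : ℤ)⟧),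
    Triangle.mk f g h ∈ distTriang C ∧ V F

lemma ReducesTo.of_distTriang {V : ObjectProperty C} {Δ : Triangle C} (hΔ : Δ ∈ distTriang C)
    (h : V Δ.obj₁) {X : C} (e : Δ.obj₂ ≅ X) : ReducesTo V X Δ.obj₃ :=
  ⟨Δ.obj₁, Δ.mor₁ ≫ e.hom, e.inv ≫ Δ.mor₂, Δ.mor₃, isomorphic_distinguished _ hΔ _
    (Triangle.isoMk _ _ (Iso.refl _) e.symm (Iso.refl _)
      (((assoc _ _ _).trans (e.hom_inv_id ▸ comp_id _)).trans (id_comp Δ.mor₁).symm)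
      (comp_id (e.inv ≫ Δ.mor₂))
      ((congr_arg (Δ.mor₃ ≫ ·) ((shiftFunctor C (1 : ℤ)).map_id _)).trans
        ((comp_id Δ.mor₃).trans (id_comp Δ.mor₃).symm))), h⟩

lemma ReducesTo.refl {V : ObjectProperty C} (hV : ∀ X, IsZero X → V X) (X : C) :
    ReducesTo V X X :=
  ⟨_, _, _, _, contractible_distinguished₁ X, hV _ (isZero_zero C)⟩

/-- By the octahedral axiom, the fibre of the composite is an extension of the two fibres. -/
lemma ReducesTo.trans [IsTriangulated C] {V : ObjectProperty C}
    (hV : ∀ Δ ∈ distTriang C, V Δ.obj₁ → V Δ.obj₃ → V Δ.obj₂) {X Y Z : C}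
    (h₁ : ReducesTo V X Y) (h₂ : ReducesTo V Y Z) : ReducesTo V X Z := by
  obtain ⟨F, f, g, h, hΔ, hF⟩ := h₁
  obtain ⟨F', f', g', h', hΔ', hF'⟩ := h₂
  obtain ⟨G, a, b, hΔ''⟩ := distinguished_cocone_triangle₁ (g ≫ g')
  let o := someOctahedron' rfl hΔ hΔ' hΔ''
  exact ⟨G, a, _, b, hΔ'', hV _ o.mem hF hF'⟩

/-- The objects of the cocomplete suspended subcategory generated by `E` which have no nonzero
morphism from `E` to their shift. -/
def suspInter (E : C) : ObjectProperty C :=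
  fun F => susp.{t} E F ∧ HomVanish E (F⟦(1 : ℤ)⟧)

lemma suspInter_of_isZero {E X : C} (hX : IsZero X) : suspInter.{t} E X :=
  ⟨(isCocompleteSuspended_susp E).prop_of_isZero hX,
    fun _ => ((shiftFunctor _ (1 : ℤ)).map_isZero hX).eq_of_tgt _ _⟩

lemma suspInter_ext {E : C} (Δ : Triangle C) (hΔ : Δ ∈ distTriang C)
    (h₁ : suspInter.{t} E Δ.obj₁) (h₃ : suspInter.{t} E Δ.obj₃) : suspInter.{t} E Δ.obj₂ :=
  ⟨(isCocompleteSuspended_susp E).ext Δ hΔ h₁.1 h₃.1, HomVanish.shift_obj₂ hΔ 1 h₁.2 h₃.2⟩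

/-- The map X → Y vanishes by orthogonality, so the identity of `X` factors through the fibre `F`,
and `X` inherits the vanishing as a retract of `F`. -/
lemma homVanish_shift_one_of_susp {E X Y : C} (hX : susp.{t} E X)
    (h : ReducesTo (suspInter.{t} E) X Y) (hY : ∀ i : ℤ, i ≤ 0 → HomVanish E (Y⟦i⟧)) :
    HomVanish E (X⟦(1 : ℤ)⟧) := by
  obtain ⟨F, f, g, h, hΔ, hF⟩ := h
  obtain ⟨r, hr⟩ := Triangle.coyoneda_exact₂ _ hΔ (𝟙 X) (homVanish_of_susp hX hY _)
  exact hF.2.of_retract_right (Retract.map ⟨r, f, hr.symm⟩ _)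

end HomVanish

/-! ### Approximation by direct sums of copies of T -/

section Approximation

open DerivedCategory

variable {S : Type u} [Ring S] [HasDerivedCategory.{w} (ModuleCat.{u} S)] {T : ModuleCat.{u} S}

/-- Every object of the derived category has a right approximation by a direct sum of copies
of `T`. -/
lemma exists_approx (p : ProjectiveResolution T) (X : DerivedCategory (ModuleCat.{u} S)) :
    ∃ (α : Type u) (f : (singleFunctor (ModuleCat.{u} S) 0).obj (∐ fun _ : α => T) ⟶ X),
      ∀ g : (singleFunctor (ModuleCat.{u} S) 0).obj T ⟶ X, ∃ h, h ≫ f = g := by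
  -- Chain maps, unlike morphisms of the derived category, form a set in the universe `u`; by
  -- K-projectivity they represent all morphisms.
  let α : Type u := p.cochainComplex ⟶ Q.objPreimage X
  let e : Q.obj (Q.objPreimage X) ≅ X := Q.objObjPreimageIso X
  obtain ⟨hc⟩ := isColimit_singleFunctor_sigma (fun _ : α => T) 0
  let f (a : α) : (singleFunctor (ModuleCat.{u} S) 0).obj T ⟶ X :=
    (qCochainComplexIso p).inv ≫ Q.map a ≫ e.hom
  refine ⟨α, Cofan.IsColimit.desc hc f, fun g => ?_⟩
  obtain ⟨a, ha⟩ := Q_map_surjective_of_isKProjective p.cochainComplex (Q.objPreimage X)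
    ((qCochainComplexIso p).hom ≫ g ≫ e.inv)
  refine ⟨(singleFunctor _ 0).map (Sigma.ι (fun _ : α => T) a),
    (Cofan.IsColimit.fac hc f a).trans ?_⟩
  simp [f, ha]

lemma homVanish_single_of_ext {M N : ModuleCat.{u} S} (i : ℕ)
    (h : ∀ x : Abelian.Ext M N i, x = 0) :
    HomVanish ((singleFunctor _ 0).obj M) (((singleFunctor _ 0).obj N)⟦(i : ℤ)⟧) := fun f => by
  have := h (Abelian.Ext.homEquiv.symm f)
  rw [Equiv.symm_apply_eq] at this
  exact this.trans (Abelian.Ext.zero_hom ..)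

lemma ext_eq_zero_of_homVanish {M N : ModuleCat.{u} S} (i : ℕ)
    (h : HomVanish ((singleFunctor _ 0).obj M) (((singleFunctor _ 0).obj N)⟦(i : ℤ)⟧))
    (x : Abelian.Ext M N i) : x = 0 :=
  Abelian.Ext.homEquiv.injective ((h _).trans (h _).symm)

variable (p : ProjectiveResolution T)
  (hT : ∀ (α : Type u) (i : ℕ), 0 < i → HomVanish ((singleFunctor _ 0).obj T)
    (((singleFunctor (ModuleCat.{u} S) 0).obj (∐ fun _ : α => T))⟦(i : ℤ)⟧))

include p hT

/-- Take the cone of an approximation T^(α) → X[-j] and shift it by j. At the new shift -j,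
surjectivity on Hom(T, -) and Ext^1(T, T^(α)) = 0 give the vanishing; at the shifts above, it is
inherited from X because the higher Ext groups vanish. -/
lemma exists_reducesTo_step (j : ℕ) (X : DerivedCategory (ModuleCat.{u} S))
    (hX : ∀ i : ℤ, -j < i → i ≤ 0 → HomVanish ((singleFunctor _ 0).obj T) (X⟦i⟧)) :
    ∃ Y, ReducesTo (suspInter.{u} ((singleFunctor _ 0).obj T)) X Y ∧
      ∀ i : ℤ, -(j + 1) < i → i ≤ 0 → HomVanish ((singleFunctor _ 0).obj T) (Y⟦i⟧) := by
  obtain ⟨α, f, hf⟩ := exists_approx p (X⟦-(j : ℤ)⟧)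
  generalize hE : (singleFunctor (ModuleCat.{u} S) 0).obj (∐ fun _ : α => T) = E at f hf
  have hE' (i : ℤ) (hi : 0 < i) : HomVanish ((singleFunctor _ 0).obj T) (E⟦i⟧) := by
    lift i to ℕ using hi.le
    rw [← hE]
    exact hT α i (by simpa using hi)
  have hsusp : susp.{u} ((singleFunctor _ 0).obj T) E := by
    rw [← hE]
    exact (isCocompleteSuspended_susp _).prop_single_sigma _ 0 fun _ => susp_self _
  obtain ⟨Y, g, h, hΔ⟩ := distinguished_cocone_triangle f
  have hΔ' := Triangle.shift_distinguished _ hΔ (j : ℤ)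
  let e : (X⟦-(j : ℤ)⟧)⟦(j : ℤ)⟧ ≅ X := (shiftEquiv' _ (-(j : ℤ)) j (by lia)).unitIso.symm.app X
  have hV : suspInter.{u} ((singleFunctor _ 0).obj T) (E⟦(j : ℤ)⟧) :=
    ⟨(isCocompleteSuspended_susp _).prop_shift _ hsusp _ (by lia),
      (HomVanish.shift_add_iff _ _ _ rfl).1 (hE' (j + 1) (by lia))⟩
  refine ⟨Y⟦(j : ℤ)⟧, ReducesTo.of_distTriang hΔ' hV e, fun i hi hi' => ?_⟩
  rw [← HomVanish.shift_add_iff (j : ℤ) i _ rfl]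
  obtain hi | rfl : -(j : ℤ) < i ∨ i = -j := by lia
  · refine HomVanish.shift_obj₃ hΔ _ _ rfl ?_ (hE' _ (by lia))
    exact (HomVanish.shift_add_iff (-(j : ℤ)) (j + i) i (by simp)).1 (hX i hi hi')
  · rw [add_neg_cancel, HomVanish.shift_zero_iff]
    intro a
    obtain ⟨b, rfl⟩ := Triangle.coyoneda_exact₃ _ hΔ a (hE' 1 (by lia) _)
    obtain ⟨c, rfl⟩ := hf b
    change (c ≫ f) ≫ g = 0
    rw [assoc, show f ≫ g = 0 from comp_distTriang_mor_zero₁₂ _ hΔ, comp_zero]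

lemma exists_reducesTo (m : ℕ) (X : DerivedCategory (ModuleCat.{u} S)) :
    ∃ Y, ReducesTo (suspInter.{u} ((singleFunctor _ 0).obj T)) X Y ∧
      ∀ i : ℤ, -m < i → i ≤ 0 → HomVanish ((singleFunctor _ 0).obj T) (Y⟦i⟧) := by
  induction m with
  | zero => exact ⟨X, ReducesTo.refl (fun _ => suspInter_of_isZero) X, by lia⟩
  | succ m hm =>
    obtain ⟨Y, hY, h⟩ := hm
    obtain ⟨Z, hZ, h'⟩ := exists_reducesTo_step p hT m Y h
    exact ⟨Z, hY.trans suspInter_ext hZ, by simpa using h'⟩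

end Approximation

/-! ### Consequences of the finite coresolution (T3) -/

section Coresolution

open DerivedCategory

variable {S : Type u} [Ring S] [HasDerivedCategory.{w} (ModuleCat.{u} S)]

/-- A property of objects closed under extensions which contains the terms of a finite
coresolution of a module `A`, in the corresponding degrees, also contains `A`. -/
lemma prop_of_coresolution {P : ObjectProperty (DerivedCategory (ModuleCat.{u} S))}
    [P.IsClosedUnderIsomorphisms]
    (hP : ∀ Δ ∈ distTriang _, P Δ.obj₁ → P Δ.obj₃ → P Δ.obj₂) (hP₀ : ∀ X, IsZero X → P X)
    {A : ModuleCat.{u} S} {K : CochainComplex (ModuleCat.{u} S) ℕ}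
    (ι : (CochainComplex.single₀ (ModuleCat.{u} S)).obj A ⟶ K) [QuasiIso ι] (n : ℕ)
    (hK : ∀ i, n < i → IsZero (K.X i))
    (h : ∀ i, i ≤ n → P ((singleFunctor _ (i : ℤ)).obj (K.X i))) :
    P ((singleFunctor _ 0).obj A) := by
  let L : CochainComplex (ModuleCat.{u} S) ℤ := K.extend ComplexShape.embeddingUpNat
  let ιExt := (ComplexShape.embeddingUpNat.extendFunctor (ModuleCat.{u} S)).map ι
  have : QuasiIso ιExt := by
    have : QuasiIso (HomologicalComplex.extendMap ι ComplexShape.embeddingUpNat) := inferInstance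
    exact this
  let e : ((HomologicalComplex.single (ModuleCat.{u} S) (.up ℤ) 0).obj A) ≅
    (ComplexShape.embeddingUpNat.extendFunctor (ModuleCat.{u} S)).obj
      ((CochainComplex.single₀ (ModuleCat.{u} S)).obj A) :=
    (HomologicalComplex.extendSingleIso ComplexShape.embeddingUpNat A 0 0 (by simp)).symm
  have hq : IsIso (Q.map (e.hom ≫ ιExt)) := (isIso_Q_map_iff_quasiIso _ _).2 inferInstance
  have : L.IsStrictlyGE 0 := by
    dsimp [L]
    infer_instance
  have : L.IsStrictlyLE n := by
    rw [CochainComplex.isStrictlyLE_iff]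
    intro i hi
    obtain ⟨k, rfl⟩ := Int.eq_ofNat_of_zero_le (show 0 ≤ i by lia)
    exact (hK k (by simpa using hi)).of_iso (HomologicalComplex.extendXIso _ _ rfl)
  refine P.prop_of_iso (show Q.obj L ≅ Q.obj _ from (asIso (Q.map (e.hom ≫ ιExt))).symm) ?_
  refine prop_Q_of_isStrictlyGE_of_isStrictlyLE hP hP₀ L 0 n fun i => ?_
  by_cases hi : 0 ≤ i ∧ i ≤ n
  · obtain ⟨k, rfl⟩ := Int.eq_ofNat_of_zero_le hi.1
    exact P.prop_of_iso ((singleFunctor _ (k : ℤ)).mapIso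
      (HomologicalComplex.extendXIso K ComplexShape.embeddingUpNat rfl).symm)
        (h k (by simpa using hi.2))
  · refine hP₀ _ ((singleFunctor _ i).map_isZero ?_)
    obtain hi | hi : i < 0 ∨ n < i := by lia
    · exact L.isZero_of_isStrictlyGE 0 i hi
    · exact L.isZero_of_isStrictlyLE n i hi

variable {T A : ModuleCat.{u} S} {K : CochainComplex (ModuleCat.{u} S) ℕ}
    (ι : (CochainComplex.single₀ (ModuleCat.{u} S)).obj A ⟶ K) [QuasiIso ι] (n : ℕ)
    (hK : ∀ i, n < i → IsZero (K.X i))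
    (h : ∀ i, i ≤ n → ∃ α : Type u, Nonempty (Retract (K.X i) (∐ fun _ : α => T)))

include ι hK h

/-- The term T_i contributes T_i[-i], which becomes T_i[n - i] after the shift, and n - i ≥ 0. -/
lemma susp_shift_of_coresolution :
    susp.{u} ((singleFunctor _ 0).obj T) (((singleFunctor _ 0).obj A)⟦(n : ℤ)⟧) := by
  have hU := isCocompleteSuspended_susp.{u} ((singleFunctor (ModuleCat.{u} S) 0).obj T)
  have hU' := hU.inverseImage_shift n
  have := hU'.isClosedUnderIsomorphisms
  refine prop_of_coresolution hU'.ext (fun _ => hU'.prop_of_isZero) ι n hK fun i hi => ?_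
  obtain ⟨α, ⟨r⟩⟩ := h i hi
  refine hU.prop_of_iso
    (((singleFunctors (ModuleCat.{u} S)).shiftIso (n : ℤ) (i - n) i (by lia)).symm.app _) ?_
  refine hU.prop_single_of_retract _ r (hU.prop_single_sigma _ _ fun _ => ?_)
  exact hU.prop_single (susp_self _) _ (by lia)

/-- `A` is glued from the T_i[-i], and a morphism T_i[-i] → Z is controlled by morphisms T → Z[i].
-/
lemma homVanish_of_coresolution (Z : DerivedCategory (ModuleCat.{u} S))
    (hZ : ∀ k : ℤ, 0 ≤ k → k ≤ n → HomVanish ((singleFunctor _ 0).obj T) (Z⟦k⟧)) :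
    HomVanish ((singleFunctor _ 0).obj A) Z := by
  let P : ObjectProperty (DerivedCategory (ModuleCat.{u} S)) := fun X => HomVanish X Z
  have : P.IsClosedUnderIsomorphisms := ⟨fun e hX => hX.of_iso_left e⟩
  refine prop_of_coresolution (P := P) (fun Δ hΔ => HomVanish.obj₂_left hΔ)
    (fun X hX => HomVanish.of_isZero_left _ hX) ι n hK fun i hi => ?_
  obtain ⟨α, ⟨r⟩⟩ := h i hi
  refine HomVanish.of_retract_left (A := (singleFunctor _ (i : ℤ)).obj (∐ fun _ : α => T)) ?_
    (r.map _)
  have := isClosedUnderColimitsOfShape_homVanish Z α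
  refine ObjectProperty.prop_of_isColimit (P := fun A => HomVanish A Z)
    (isColimit_singleFunctor_sigma (fun _ : α => T) (i : ℤ)).some fun j => ?_
  have := (HomVanish.shift_left_iff (-(i : ℤ)) i 0 (by lia)).2 (hZ i (by lia) (by lia))
  refine (HomVanish.shift_zero_iff.1 this).of_iso_left ?_
  exact ((singleFunctors (ModuleCat.{u} S)).shiftIso (-(i : ℤ)) i 0 (by lia)).app T

end Coresolution

/-! ### The truncation triangle for an arbitrary object -/

section Truncation

open DerivedCategory

variable {S : Type u} [Ring S] [HasDerivedCategory.{w} (ModuleCat.{u} S)] {T : ModuleCat.{u} S}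

lemma homVanish_of_isGE (M : ModuleCat.{u} S) (X : DerivedCategory (ModuleCat.{u} S)) (a i : ℤ)
    [X.IsGE a] (hi : i < a) : HomVanish ((singleFunctor _ 0).obj M) (X⟦i⟧) := fun f => by
  have := TStructure.t.isGE_shift X a i (a - i) (by lia)
  exact TStructure.t.zero f 0 (a - i) (by lia)

lemma homVanish_of_isLE (p : ProjectiveResolution T) (n : ℕ)
    (hp : ∀ i, n < i → IsZero (p.complex.X i)) (X : DerivedCategory (ModuleCat.{u} S)) (a i : ℤ)
    [X.IsLE a] (hi : a + n < i) : HomVanish ((singleFunctor _ 0).obj T) (X⟦i⟧) := fun f => by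
  have := TStructure.t.isLE_shift X a i (a - i) (by lia)
  have := TStructure.t.isLE_of_le (X⟦i⟧) (a - i) (-n - 1) (by lia)
  exact eq_zero_of_projectiveResolution p n hp _ f

variable (p : ProjectiveResolution T) (n : ℕ)
  (hp : ∀ i, n < i → IsZero (p.complex.X i))
  (hT : ∀ (α : Type u) (i : ℕ), 0 < i → HomVanish ((singleFunctor _ 0).obj T)
    (((singleFunctor (ModuleCat.{u} S) 0).obj (∐ fun _ : α => T))⟦(i : ℤ)⟧))
  (hU : ∀ X : DerivedCategory (ModuleCat.{u} S), X.IsLE (-n) →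
    susp.{u} ((singleFunctor _ 0).obj T) X)
  (hS : ∀ Z : DerivedCategory (ModuleCat.{u} S),
    (∀ k : ℤ, 0 ≤ k → k ≤ n → HomVanish ((singleFunctor _ 0).obj T) (Z⟦k⟧)) →
      HomVanish ((singleFunctor _ 0).obj (ModuleCat.of S S)) Z)

include p hp hT hU hS

lemma exists_reducesTo_homVanish (X : DerivedCategory (ModuleCat.{u} S)) :
    ∃ Y, ReducesTo (suspInter.{u} ((singleFunctor _ 0).obj T)) X Y ∧
      ∀ i : ℤ, i ≤ 0 → HomVanish ((singleFunctor _ 0).obj T) (Y⟦i⟧) := by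
  -- Of the 2n steps, n pay for the length of the coresolution when reading off cohomology, and n
  -- for the projective dimension of T.
  obtain ⟨Z, hXZ, hZ⟩ := exists_reducesTo p hT (2 * n) X
  obtain ⟨F, Y, hF, hY, f, g, h, hΔ⟩ :=
    TStructure.t.exists_triangle Z (-n : ℤ) (-n + 1) rfl
  have hF : F.IsLE (-n) := ⟨hF⟩
  have hY : Y.IsGE (-n + 1) := ⟨hY⟩
  have hF' : F.IsLE (-(2 * n)) := by
    rw [isLE_iff]
    intro i hi
    by_cases hi' : -n < i
    · exact isZero_of_isLE F (-n) i hi'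
    refine isZero_homology_of_single F i ?_
    -- For -2n < i ≤ -n, Hom(S, F[i]) lies between Hom(S, Y[i-1]), zero for degree reasons, and
    -- Hom(S, Z[i]), zero by `hS` since i + k stays in (-2n, 0] for 0 ≤ k ≤ n.
    refine HomVanish.shift_obj₁ hΔ i (i - 1) (by lia)
      (homVanish_of_isGE _ Y (-n + 1) _ (by lia)) (hS _ fun k hk hk' => ?_)
    exact (HomVanish.shift_add_iff _ _ (i + k) rfl).1
      (hZ _ (by push_cast; lia) (by lia))
  refine ⟨Y, hXZ.trans suspInter_ext
    ⟨F, f, g, h, hΔ, hU F hF, homVanish_of_isLE p n hp F (-(2 * n)) 1 (by lia)⟩, fun i hi => ?_⟩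
  by_cases hi' : i ≤ -n
  · exact homVanish_of_isGE _ Y (-n + 1) _ (by lia)
  · refine HomVanish.shift_obj₃ hΔ i _ rfl (hZ i (by push_cast; lia) hi)
      (homVanish_of_isLE p n hp F (-(2 * n)) _ (by lia))

end Truncation

/-! ### The t-structure generated by an object -/

section TStructure

variable {C : Type u} [Category.{v} C] [Preadditive C] [HasShift C ℤ]

lemma suspCoaisle_shift_iff {E B : C} (n : ℤ) :
    suspCoaisle E (B⟦n⟧) ↔ ∀ j : ℤ, j < n → HomVanish E (B⟦j⟧) := by
  refine ⟨fun h j hj => ?_, fun h j hj => ?_⟩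
  · exact (HomVanish.shift_add_iff n (j - n) j (by lia)).2 (h _ (by lia))
  · exact (HomVanish.shift_add_iff n j _ rfl).1 (h (n + j) (by lia))

instance (E : C) : (suspCoaisle E).IsClosedUnderIsomorphisms where
  of_iso e h j hj := HomVanish.of_iso_right (h j hj) ((shiftFunctor C j).mapIso e)

variable [HasZeroObject C] [∀ (n : ℤ), (shiftFunctor C n).Additive] [Pretriangulated C]

instance (E : C) : (susp.{t} E).IsClosedUnderIsomorphisms :=
  (isCocompleteSuspended_susp E).isClosedUnderIsomorphisms

/-- The t-structure generated by an object `E`, if every object `X` has a morphism to an object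
without morphisms from `E⟦i⟧`, `i ≥ 0`, with cocone in the cocomplete suspended
subcategory generated by `E`. -/
def suspTStructure (E : C) (h : ∀ X : C, ∃ Y, ReducesTo (suspInter.{t} E) X Y ∧
    ∀ i : ℤ, i ≤ 0 → HomVanish E (Y⟦i⟧)) : TStructure C where
  le n := (susp.{t} E).inverseImage (shiftFunctor C n)
  ge n := (suspCoaisle E).inverseImage (shiftFunctor C n)
  le_shift n a n' hn X hX := (susp.{t} E).prop_of_iso ((shiftFunctorAdd' C a n' n hn).app X) hX
  ge_shift n a n' hn X hX := (suspCoaisle E).prop_of_iso ((shiftFunctorAdd' C a n' n hn).app X) hX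
  zero' X Y f hX hY := by
    refine homVanish_of_susp ((susp.{t} E).prop_of_iso ((shiftFunctorZero C ℤ).app X) hX)
      (fun i hi => ?_) f
    exact (suspCoaisle_shift_iff 1).1 hY i (by lia)
  le_zero_le X hX := (isCocompleteSuspended_susp E).shift _
    ((susp.{t} E).prop_of_iso ((shiftFunctorZero C ℤ).app X) hX)
  ge_one_le X hX :=
    (suspCoaisle_shift_iff 0).2 fun j hj => (suspCoaisle_shift_iff 1).1 hX j (by lia)
  exists_triangle_zero_one X := by
    obtain ⟨Y, ⟨F, f, g, h, hΔ, hF⟩, hY⟩ := h X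
    exact ⟨F, Y, (susp.{t} E).prop_of_iso ((shiftFunctorZero C ℤ).symm.app F) hF.1,
      (suspCoaisle_shift_iff 1).2 fun j hj => hY j (by lia), f, g, h, hΔ⟩

variable (E : C) (h : ∀ X : C, ∃ Y, ReducesTo (suspInter.{t} E) X Y ∧
    ∀ i : ℤ, i ≤ 0 → HomVanish E (Y⟦i⟧))

lemma suspTStructure_le_zero : (suspTStructure E h).le 0 = susp.{t} E := by
  ext X
  exact (susp.{t} E).prop_iff_of_iso ((shiftFunctorZero C ℤ).app X)

lemma suspTStructure_ge_zero : (suspTStructure E h).ge 0 = suspCoaisle E := by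
  ext X
  exact (suspCoaisle E).prop_iff_of_iso ((shiftFunctorZero C ℤ).app X)

/-- The aisle is a left orthogonal class, whence closure under extensions and coproducts. -/
lemma isCocompleteSuspended_le_zero (D : TStructure C) : IsCocompleteSuspended.{t} (D.le 0) := by
  have key (X : C) : D.le 0 X ↔ ∀ Y, D.ge 1 Y → HomVanish X Y := by
    rw [D.le_iff_isLE, D.isLE_iff_orthogonal 0 1 rfl]
    exact ⟨fun h Y hY f => h Y f ⟨hY⟩, fun h Y f hY => h Y hY.ge f⟩
  refine ⟨fun Δ hΔ h₁ h₃ => ?_, fun X hX => ?_, fun J => ⟨?_⟩⟩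
  · rw [key] at *
    exact fun Y hY => HomVanish.obj₂_left hΔ (h₁ Y hY) (h₃ Y hY)
  · exact D.le_monotone (a := -1) (b := 0) (by lia) _ (D.le_shift 0 1 (-1) rfl X hX)
  · rintro X ⟨p⟩
    rw [key]
    intro Y hY
    have := isClosedUnderColimitsOfShape_homVanish Y J
    exact ObjectProperty.prop_of_isColimit (P := fun A => HomVanish A Y)
      p.isColimit fun j => (key _).1 (p.prop_diag_obj j) Y hY

end TStructure

/-! ### The type of the pair of t-structures -/

section Main

open DerivedCategory

variable {S : Type u} [Ring S] [HasDerivedCategory.{w} (ModuleCat.{u} S)] {T : ModuleCat.{u} S}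

/-- The t-structure generated by `T` has type `(n, 0)` with respect to the natural one. -/
lemma hasType_suspTStructure (n : ℕ) (hpd : projectiveDimension T = (n : WithBot ℕ∞))
    (h : ∀ X, ∃ Y, ReducesTo (suspInter.{u} ((singleFunctor (ModuleCat.{u} S) 0).obj T)) X Y ∧
      ∀ i : ℤ, i ≤ 0 → HomVanish ((singleFunctor (ModuleCat.{u} S) 0).obj T) (Y⟦i⟧))
    (hU : ∀ X : DerivedCategory (ModuleCat.{u} S), X.IsLE (-n) →
      susp.{u} ((singleFunctor _ 0).obj T) X) :
    HasType TStructure.t (suspTStructure _ h) n 0 := by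
  have hle : susp.{u} ((singleFunctor _ 0).obj T) ≤ TStructure.t.le 0 := fun X hX =>
    hX _ (isCocompleteSuspended_le_zero _) (TStructure.t.le_of_isLE _ 0)
  refine ⟨⟨?_, fun m hm => ?_⟩, ⟨?_, fun m hm => ?_⟩⟩
  · change TStructure.le _ _ ≤ TStructure.t.le 0
    rwa [suspTStructure_le_zero]
  · by_contra! hm'
    -- For m > 0, T[-m] would lie in D^{≤ 0} while being concentrated in degree m; then T = 0, whose
    -- projective dimension is `⊥`.
    let X := ((singleFunctor (ModuleCat.{u} S) 0).obj T)⟦-m⟧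
    have h₁ : X.IsLE 0 := ⟨hm _ ((susp.{u} ((singleFunctor _ 0).obj T)).prop_of_iso
      ((shiftEquiv' _ (-m) m (by lia)).unitIso.app _) (susp_self _))⟩
    have h₂ : X.IsGE m := TStructure.t.isGE_shift _ 0 (-m) m (by lia)
    have h₃ : IsZero ((singleFunctor (ModuleCat.{u} S) 0).obj T) :=
      ((shiftFunctor _ m).map_isZero (TStructure.t.isZero X 0 m)).of_iso
        ((shiftEquiv' _ (-m) m (by lia)).unitIso.app _)
    have h₄ : IsZero T := by
      rw [IsZero.iff_id_eq_zero]
      exact (singleFunctor _ 0).map_injective (h₃.eq_of_src _ _)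
    rw [(projectiveDimension_eq_bot_iff T).2 h₄] at hpd
    exact absurd hpd (by simp)
  · change TStructure.t.le _ ≤ TStructure.le _ _
    rw [suspTStructure_le_zero]
    exact fun X hX => hU X ⟨hX⟩
  · by_contra! hm'
    -- For i ≥ n > m, M[i-1] lies in D^{≤ 1-i} ⊆ D^{≤ -m} ⊆ U, so Hom(T, M[i]) = 0.
    have : HasProjectiveDimensionLT T n := by
      rw [hasProjectiveDimensionLT_iff]
      intro i hi M
      refine ext_eq_zero_of_homVanish i ?_
      obtain ⟨Y, hY, hY'⟩ := h (((singleFunctor _ 0).obj M)⟦(i - 1 : ℤ)⟧)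
      have hM : (((singleFunctor (ModuleCat.{u} S) 0).obj M)⟦(i - 1 : ℤ)⟧).IsLE (-m) :=
        have := TStructure.t.isLE_shift ((singleFunctor (ModuleCat.{u} S) 0).obj M) 0
          (i - 1) (1 - i) (by lia)
        TStructure.t.isLE_of_le _ (1 - i) _ (by lia)
      have hM' := hm _ hM.le
      rw [suspTStructure_le_zero] at hM'
      exact (HomVanish.shift_add_iff (i - 1 : ℤ) 1 _ (by lia)).2
        (homVanish_shift_one_of_susp hM' hY hY')
    exact absurd hpd (projectiveDimension_lt_iff.2 this).ne

end Main

/-- The right module `R` is free of rank one over the opposite ring. -/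
def opSelfIso (R : Type u) [Ring R] : ModuleCat.of Rᵐᵒᵖ Rᵐᵒᵖ ≅ ModuleCat.of Rᵐᵒᵖ R :=
  LinearEquiv.toModuleIso
    { (MulOpposite.opAddEquiv : R ≃+ Rᵐᵒᵖ).symm with
      map_smul' := fun _ _ => rfl }

end

theorem lemma2p3 {R : Type u} [Ring R] [HasDerivedCategory.{w} (ModuleCat.{u} Rᵐᵒᵖ)]
    (n : ℕ) (T : ModuleCat.{u} Rᵐᵒᵖ) (hT : IsTilting n T)
    (hpd : projectiveDimension T = (n : WithBot ℕ∞)) :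
    ∃ S : TStructure (DerivedCategory (ModuleCat.{u} Rᵐᵒᵖ)),
      S.le 0 = susp.{u} (toDerived T) ∧
      S.ge 0 = suspCoaisle (toDerived T) ∧
      HasType DerivedCategory.TStructure.t S n 0 := by
  obtain ⟨p, hp⟩ := hT.resolution
  obtain ⟨K, ι, _, hK, hK'⟩ := hT.coresolution
  have hR : susp.{u} (toDerived T) ((toDerived (ModuleCat.of Rᵐᵒᵖ Rᵐᵒᵖ))⟦(n : ℤ)⟧) :=
    (susp.{u} (toDerived T)).prop_of_iso
      ((shiftFunctor _ (n : ℤ)).mapIso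
        ((DerivedCategory.singleFunctor _ 0).mapIso (opSelfIso R).symm))
      (susp_shift_of_coresolution ι n hK' hK)
  have hU (X : DerivedCategory (ModuleCat.{u} Rᵐᵒᵖ)) (hX : X.IsLE (-n)) :
      susp.{u} (toDerived T) X := by
    have : (X⟦(-n : ℤ)⟧).IsLE 0 := DerivedCategory.TStructure.t.isLE_shift X (-n) (-n) 0
    exact (susp.{u} (toDerived T)).prop_of_iso
      ((shiftEquiv' _ (-n : ℤ) n (by lia)).unitIso.symm.app X)
      (((isCocompleteSuspended_susp _).inverseImage_shift n).prop_of_isLE_zero hR (X⟦(-n : ℤ)⟧))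
  have h := exists_reducesTo_homVanish p n hp
    (fun α i hi => homVanish_single_of_ext i (hT.ext_eq_zero i hi α)) hU fun Z hZ =>
      (homVanish_of_coresolution ι n hK' hK Z hZ).of_iso_left
        ((DerivedCategory.singleFunctor _ 0).mapIso (opSelfIso R).symm)
  exact ⟨suspTStructure _ h, suspTStructure_le_zero _ h, suspTStructure_ge_zero _ h,
    hasType_suspTStructure n hpd h hU⟩
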